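/- All graphs are finite, simple and undirected. For a graph $G$ on $n$ vertices, two disjoint vertex sets are *impure* towards each other if they are neither completely adjacent nor completely non-adjacent. A *contraction sequence* of $G$ is a sequence $\mathcal P_1,\dots,\mathcal P_n$ of partitions of $V(G)$ where $\mathcal P_1$ is the partition into singletons, $\mathcal P_n$ has one part, and each $\mathcal P_{t}$ with $t>1$ arises from $\mathcal P_{t-1}$ by merging two distinct parts. Its *width* is the maximum, over all $t$ and all $P\in\mathcal P_t$, of the number of parts of $\mathcal P_t$ other than $P$ that are impure towards $P$, and the *twin-width* of $G$ is the minimum width of a contraction sequence of $G$. For a first-order formula $\varphi(\bar x,\bar y)$ in the language of graphs (adjacency and equality), whose free variables are partitioned into finite tuples $\bar x$ and $\bar y$, and for $A\subseteq V(G)$, let $$S^{\varphi}(A)=\bigl\{\{\bar a\in A^{\bar x} : G\models\varphi(\bar a,\bar b)\} : \bar b\in V(G)^{\bar y}\bigr\}.$$ **Theorem.** For every $d\in\mathbb N$ and every first-order formula $\varphi(\bar x,\bar y)$ there is a constant $C=C(d,\varphi)$ such that for every graph $G$ of twin-width at most $d$ and every nonempty $A\subseteq V(G)$, $$|S^{\varphi}(A)|\le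 C\cdot |A|^{|\bar y|}.$$ The bound is asymptotically optimal, already for edgeless graphs (whose twin-width is $0$): for all finite tuples of variables $\bar x,\bar y$ with $\bar x$ nonempty there are a first-order formula $\varphi(\bar x,\bar y)$ and a constant $c>0$ such that $|S^{\varphi}(A)|\ge c\cdot|A|^{|\bar y|}$ for every edgeless graph $G$ and every $A\subseteq V(G)$. -/

import Mathlib

open FirstOrder

universe u v w

namespace TwinWidth

/-- The pair `A, B` is complete: every vertex of `A` is adjacent to every vertex of `B`. -/
def IsComplete {V : Type u} (G : SimpleGraph V) (A B : Finset V) : Prop :=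
  ∀ a ∈ A, ∀ b ∈ B, G.Adj a b

/-- The pair `A, B` is anti-complete: there is no edge between `A` and `B`. -/
def IsAnticomplete {V : Type u} (G : SimpleGraph V) (A B : Finset V) : Prop :=
  ∀ a ∈ A, ∀ b ∈ B, ¬ G.Adj a b

/-- The pair `A, B` is impure: neither complete nor anti-complete. -/
def IsImpure {V : Type u} (G : SimpleGraph V) (A B : Finset V) : Prop :=
  ¬ IsComplete G A B ∧ ¬ IsAnticomplete G A B

/-- The impurity graph of the quotient trigraph `G / P`: its vertices are the parts of `P`, and
two distinct parts are adjacent when they are impure towards each other in `G`. -/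
def impurityGraph {V : Type u} [Fintype V] [DecidableEq V] (G : SimpleGraph V)
    (P : Finpartition (Finset.univ : Finset V)) : SimpleGraph {A : Finset V // A ∈ P.parts} where
  Adj A B := A ≠ B ∧ IsImpure G A.1 B.1
  symm := ⟨fun _ _ h => ⟨h.1.symm,
    fun hc => h.2.1 fun a ha b hb => (hc b hb a ha).symm,
    fun hc => h.2.2 fun a ha b hb hab => hc b hb a ha hab.symm⟩⟩
  loopless := ⟨fun _ h => h.1 rfl⟩

/-- A contraction sequence on a vertex set with `n` elements: partitions indexed by
`0, …, n - 1`, the first one into singletons, the last one with a single part, each obtained from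
the previous one by merging two distinct parts. (For `n = 0` it is the empty sequence.) -/
structure ContractionSequence (V : Type u) [Fintype V] [DecidableEq V] where
  partition : Fin (Fintype.card V) → Finpartition (Finset.univ : Finset V)
  first : ∀ h : 0 < Fintype.card V, partition ⟨0, h⟩ = ⊥
  last : ∀ t : Fin (Fintype.card V), (t : ℕ) + 1 = Fintype.card V →
    (partition t).parts = {Finset.univ}
  step : ∀ (t : ℕ) (h : t + 1 < Fintype.card V),
    ∃ A ∈ (partition ⟨t, Nat.lt_of_succ_lt h⟩).parts,
    ∃ B ∈ (partition ⟨t, Nat.lt_of_succ_lt h⟩).parts,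
      A ≠ B ∧ (partition ⟨t + 1, h⟩).parts =
        insert (A ∪ B) (((partition ⟨t, Nat.lt_of_succ_lt h⟩).parts.erase A).erase B)

open scoped Classical in
/-- The width of a contraction sequence: the maximum degree occurring in the impurity graphs of
its partitions. -/
noncomputable def ContractionSequence.width {V : Type u} [Fintype V] [DecidableEq V]
    (S : ContractionSequence V) (G : SimpleGraph V) : ℕ :=
  Finset.univ.sup fun t => (impurityGraph G (S.partition t)).maxDegree

/-- The twin-width of a finite graph: the minimum width of a contraction sequence. -/
noncomputable def twinWidth {V : Type u} [Fintype V] [DecidableEq V] (G : SimpleGraph V) : ℕ∞ :=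
  ⨅ S : ContractionSequence V, (S.width G : ℕ∞)

/-- For a first-order formula `φ(x, y)` in the language of graphs, with the variables `x` indexed
by `α` and the variables `y` indexed by `β`, the set `{a ∈ A^x : G ⊨ φ(a, b)}`. -/
def definedSet {α : Type v} {β : Type w} {V : Type u} (G : SimpleGraph V)
    (φ : Language.graph.Formula (α ⊕ β)) (A : Finset V) (b : β → V) : Set (α → V) :=
  {a | (∀ i, a i ∈ A) ∧
    @Language.Formula.Realize Language.graph V G.structure (α ⊕ β) φ (Sum.elim a b)}

/-- The Stone space: all sets `{a ∈ A^x : G ⊨ φ(a, b)}` for `b ∈ V(G)^y`. -/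
def stoneSpace {α : Type v} {β : Type w} {V : Type u} (G : SimpleGraph V)
    (φ : Language.graph.Formula (α ⊕ β)) (A : Finset V) : Set (Set (α → V)) :=
  Set.range fun b : β → V => definedSet G φ A b

end TwinWidth

/-!
Follow the equivalence relations `r t` of a contraction sequence of width `d`, and play on two
copies of the graph the Ehrenfeucht–Fraïssé game of `q` rounds in which every vertex is coloured
by its class modulo `r t`. At time `0` the colours determine the vertices, at the end there is
only one colour, and in between the colouring only gets coarser, so that tuples can only become
equivalent. Since the red degree is bounded, a merge changes nothing for tuples far away from the
merged class in the red graph. Hence the tuples from a set `B` become equivalent to one another at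
only `O(|B|)` times.

A tuple `b` is described through its bases: sets `J` of indices such that tuples from `A` which
are equivalent over the entries of `b` in `J` are equivalent over the whole of `b`. The empty set
is a base at time `0`. Wait until a given base has to be extended: this happens at one of `O(|A|)`
times, and at that time a further entry of `b` is close to the merged class, which leaves `O(1)`
choices for it up to equivalence. After `|y|` extensions there are `O(|A|^|y|)` descriptions, and
the description of `b` determines the set that `b` defines in `A`.

For the lower bound, let the formula say that one fixed entry of `x` occurs in `y`. The set
defined by a tuple from `A` determines its set of entries, so it is shared by at most `|y|^|y|`
such tuples.
-/

namespace TwinWidth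

section Counting

lemma encard_biUnion_le_mul {α : Type u} {β : Type v} {s : Set α} {f : α → Set β} {k : ℕ∞}
    (hf : ∀ i ∈ s, (f i).encard ≤ k) : (⋃ i ∈ s, f i).encard ≤ s.encard * k := by
  rcases s.finite_or_infinite with hs | hs
  · lift s to Finset α using hs
    rw [Set.encard_coe_eq_coe_finsetCard, ← nsmul_eq_mul]
    exact (s.set_encard_biUnion_le f).trans (s.sum_le_card_nsmul _ k hf)
  · rcases eq_or_ne k 0 with rfl | hk
    · have hempty : ∀ i ∈ s, f i = ∅ := fun i hi =>
        Set.encard_eq_zero.1 (nonpos_iff_eq_zero.1 (hf i hi))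
      simp [Set.iUnion₂_congr hempty]
    · simp [hs.encard_eq, ENat.top_mul hk]

lemma encard_pi_univ_le {κ : Type u} [Finite κ] {α : κ → Type v} {F : ∀ i, Set (α i)} {L : ℕ∞}
    (hF : ∀ i, (F i).encard ≤ L) : (Set.pi Set.univ F).encard ≤ L ^ Nat.card κ := by
  have := Fintype.ofFinite κ
  rw [Set.encard_pi_eq_prod_encard, Nat.card_eq_fintype_card]
  exact Finset.prod_le_pow_card _ _ _ fun i _ => hF i

lemma exists_injOn_fin {α : Type u} {n : ℕ} {s : Set α} (hs : s.encard ≤ n) :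
    ∃ g : α → Fin (n + 1), Set.InjOn g s := by
  classical
  have hfin : s.Finite := Set.finite_of_encard_le_coe hs
  have := hfin.fintype
  have hcard : Fintype.card s ≤ Fintype.card (Fin (n + 1)) := by
    have h : (Fintype.card s : ℕ∞) ≤ n := by
      rwa [← ENat.card_eq_coe_fintype_card, ENat.card_coe_set_eq]
    simpa using Nat.le_succ_of_le (Nat.cast_le.1 h)
  obtain ⟨e⟩ := Function.Embedding.nonempty_of_card_le hcard
  refine ⟨fun a => if h : a ∈ s then e ⟨a, h⟩ else 0, fun a ha b hb hab => ?_⟩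
  simpa [ha, hb] using hab

lemma exists_representatives {α : Type u} {Z : Type v} [Finite Z] (f : α → Z) (s : Set α) :
    ∃ t ⊆ s, t.encard ≤ Nat.card Z ∧ ∀ x ∈ s, ∃ y ∈ t, f x = f y := by
  obtain ⟨t, hts, ht⟩ := Set.exists_subset_bijOn s f
  refine ⟨t, hts, ?_, fun x hx => ?_⟩
  · rw [← ht.injOn.encard_image, ht.image_eq, ← ENat.card_eq_coe_natCard]
    exact (Set.encard_le_encard (Set.subset_univ _)).trans_eq (Set.encard_univ Z)
  · obtain ⟨y, hy, hxy⟩ := ht.surjOn (Set.mem_image_of_mem f hx)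
    exact ⟨y, hy, hxy.symm⟩

lemma exists_gap {κ : Type u} [Finite κ] {α : Type v} [LinearOrder α] {a : ℕ → α}
    (ha : Monotone a) (f : κ → α) :
    ∃ l ≤ Nat.card κ, ∀ i, f i ≤ a (l + 1) → f i ≤ a l := by
  by_contra! h
  choose i hi hi' using fun l : Fin (Nat.card κ + 1) => h l (Nat.lt_succ_iff.1 l.2)
  have hinj : Function.Injective i := by
    refine Function.Injective.of_lt_imp_ne fun l m hlm heq => ?_
    have hlt : a m < f (i l) := heq ▸ hi' m
    exact (hlt.trans_le ((hi l).trans (ha (Nat.succ_le_of_lt hlm)))).false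
  simpa using Nat.card_le_card_of_injective _ hinj

lemma card_quotient_le_of_le {α : Type u} {r s : Setoid α} (h : r ≤ s) [Finite (Quotient r)] :
    Nat.card (Quotient s) ≤ Nat.card (Quotient r) :=
  Nat.card_le_card_of_surjective (Setoid.map_of_le h) (Quotient.ind fun x => ⟨⟦x⟧, rfl⟩)

lemma card_quotient_lt_of_lt {α : Type u} {r s : Setoid α} (h : r < s) [Finite (Quotient r)] :
    Nat.card (Quotient s) < Nat.card (Quotient r) := by
  refine (card_quotient_le_of_le h.le).lt_of_ne fun hcard => h.not_ge fun x y hxy => ?_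
  have hsurj : Function.Surjective (Setoid.map_of_le h.le) := Quotient.ind fun x => ⟨⟦x⟧, rfl⟩
  exact Quotient.exact ((hsurj.bijective_of_nat_card_le hcard.ge).1
    (Quotient.sound hxy : (⟦x⟧ : Quotient s) = ⟦y⟧))

/-- The numbers of classes just after the counted coarsenings are distinct and below `K`. -/
lemma encard_setOf_ne_succ_le {α : Type u} {r : ℕ → Setoid α} (hr : Monotone r) (K : ℕ) :
    {t | ENat.card (Quotient (r t)) ≤ K ∧ r t ≠ r (t + 1)}.encard ≤ K := by
  have hfin : ∀ {t}, ENat.card (Quotient (r t)) ≤ K → Finite (Quotient (r t)) := fun h =>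
    ENat.card_lt_top.1 (h.trans_lt (ENat.natCast_lt_top K))
  have hdrop : ∀ {t}, ENat.card (Quotient (r t)) ≤ K → r t ≠ r (t + 1) →
      Nat.card (Quotient (r (t + 1))) < Nat.card (Quotient (r t)) := fun h hne =>
    have := hfin h
    card_quotient_lt_of_lt ((hr (Nat.le_succ _)).lt_of_ne hne)
  refine (Set.encard_le_encard_of_injOn (t := {i | i < K})
    (f := fun t => Nat.card (Quotient (r (t + 1)))) ?_ ?_).trans_eq (Set.Nat.encard_range K)
  · rintro t ⟨hK, hne⟩
    have := hfin hK
    refine (hdrop hK hne).trans_le ?_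
    rwa [ENat.card_eq_coe_natCard, Nat.cast_le] at hK
  · refine StrictAntiOn.injOn fun t ht t' ht' htt' => (hdrop ht'.1 ht'.2).trans_le ?_
    have := hfin ht.1
    have : Finite (Quotient (r (t + 1))) := .of_surjective
      (Setoid.map_of_le (hr t.le_succ)) (Quotient.ind fun x => ⟨⟦x⟧, rfl⟩)
    exact card_quotient_le_of_le (hr htt')

end Counting

section RedGraph

lemma edist_map_le {X : Type u} {Y : Type v} {H : SimpleGraph X} {H' : SimpleGraph Y} {f : X → Y}
    (hf : ∀ a b, H.Adj a b → f a = f b ∨ H'.Adj (f a) (f b)) (a b : X) :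
    H'.edist (f a) (f b) ≤ H.edist a b := by
  have walk_bound : ∀ {a b} (W : H.Walk a b), H'.edist (f a) (f b) ≤ W.length := by
    intro a b W
    induction W with
    | nil => simp
    | @cons a b c hab W ih =>
      have hle : H'.edist (f a) (f b) ≤ 1 :=
        SimpleGraph.edist_le_one_iff_adj_or_eq.2 (hf a b hab).symm
      calc H'.edist (f a) (f c) ≤ H'.edist (f a) (f b) + H'.edist (f b) (f c) :=
            SimpleGraph.edist_triangle
        _ ≤ 1 + W.length := add_le_add hle ih
        _ = (SimpleGraph.Walk.cons hab W).length := by simp [add_comm]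
  exact le_iInf walk_bound

lemma encard_setOf_edist_le {X : Type u} {H : SimpleGraph X} {d : ℕ}
    (hd : ∀ a, (H.neighborSet a).encard ≤ d) (n : ℕ) (a : X) :
    {b | H.edist a b ≤ n}.encard ≤ (d + 1 : ℕ) ^ n := by
  induction n generalizing a with
  | zero => simp
  | succ n ih =>
    have hcard : (insert a (H.neighborSet a)).encard ≤ (d + 1 : ℕ) :=
      (Set.encard_insert_le _ _).trans (by push_cast; gcongr; exact hd a)
    have hsub : {b | H.edist a b ≤ (n + 1 : ℕ)} ⊆
        ⋃ c ∈ insert a (H.neighborSet a), {b | H.edist c b ≤ n} := by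
      intro b hb
      obtain ⟨W, hW⟩ :=
        SimpleGraph.exists_walk_of_edist_ne_top (ne_top_of_le_ne_top (ENat.natCast_ne_top _) hb)
      rw [Set.mem_ofPred_eq, ← hW, Nat.cast_le] at hb
      cases W with
      | nil => exact Set.mem_biUnion (Set.mem_insert _ _) (by simp)
      | cons hac W =>
        refine Set.mem_biUnion (Set.mem_insert_of_mem _ hac) (W.edist_le.trans ?_)
        exact Nat.cast_le.2 (Nat.le_of_succ_le_succ hb)
    calc _ ≤ _ := Set.encard_le_encard hsub
      _ ≤ _ := encard_biUnion_le_mul fun c _ => ih c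
      _ ≤ _ := by rw [pow_succ']; gcongr

variable {V : Type u} {G : SimpleGraph V} {r s : Setoid V}

/-- The red graph of the quotient trigraph `G / r`: two distinct classes are adjacent when there
are both an edge and a non-edge between them. -/
def redGraph (G : SimpleGraph V) (r : Setoid V) : SimpleGraph (Quotient r) where
  Adj a b := a ≠ b ∧ (∃ x y, ⟦x⟧ = a ∧ ⟦y⟧ = b ∧ G.Adj x y) ∧ ∃ x y, ⟦x⟧ = a ∧ ⟦y⟧ = b ∧ ¬G.Adj x y
  symm := ⟨fun _ _ ⟨hne, ⟨x, y, hx, hy, h⟩, x', y', hx', hy', h'⟩ =>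
    ⟨hne.symm, ⟨y, x, hy, hx, h.symm⟩, y', x', hy', hx', fun h => h' h.symm⟩⟩
  loopless := ⟨fun _ h => h.1 rfl⟩

/-- The classes of `r` have degree at most `d` in the red graph. -/
def RedDegreeLE (G : SimpleGraph V) (r : Setoid V) (d : ℕ) : Prop :=
  ∀ a, ((redGraph G r).neighborSet a).encard ≤ d

lemma RedDegreeLE.encard_ball_le {d : ℕ} (h : RedDegreeLE G r d) (n : ℕ) (a : Quotient r) :
    {b | (redGraph G r).edist a b ≤ n}.encard ≤ ((d + 1) ^ n : ℕ) :=
  (encard_setOf_edist_le h n a).trans_eq (by push_cast; rfl)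

/-- The distance of the classes of two vertices in the red graph of `G / r`. -/
noncomputable def redDist (G : SimpleGraph V) (r : Setoid V) (x y : V) : ℕ∞ :=
  (redGraph G r).edist ⟦x⟧ ⟦y⟧

lemma redDist_eq_zero {x y : V} : redDist G r x y = 0 ↔ r x y :=
  SimpleGraph.edist_eq_zero_iff.trans Quotient.eq

lemma redDist_comm (x y : V) : redDist G r x y = redDist G r y x :=
  SimpleGraph.edist_comm

lemma redDist_triangle (x y z : V) : redDist G r x z ≤ redDist G r x y + redDist G r y z :=
  SimpleGraph.edist_triangle

lemma redDist_congr {x x' y y' : V} (hx : r x x') (hy : r y y') :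
    redDist G r x y = redDist G r x' y' := by
  rw [redDist, redDist, Quotient.sound hx, Quotient.sound hy]

lemma redDist_anti (h : r ≤ s) (x y : V) : redDist G s x y ≤ redDist G r x y := by
  refine edist_map_le (f := Setoid.map_of_le h) ?_ _ _
  rintro _ _ ⟨-, ⟨x, y, rfl, rfl, hadj⟩, x', y', hx, hy, hnadj⟩
  refine or_iff_not_imp_left.2 fun hne => ⟨hne, ⟨x, y, rfl, rfl, hadj⟩, x', y', ?_, ?_, hnadj⟩
  · exact congrArg (Setoid.map_of_le h) hx
  · exact congrArg (Setoid.map_of_le h) hy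

lemma adj_congr_of_one_lt_redDist {x x' y y' : V} (hx : r x x') (hy : r y y')
    (h : 1 < redDist G r x y) : G.Adj x y ↔ G.Adj x' y' := by
  have hfar : ¬((redGraph G r).Adj ⟦x⟧ ⟦y⟧ ∨ (⟦x⟧ : Quotient r) = ⟦y⟧) :=
    fun hxy => h.not_ge (SimpleGraph.edist_le_one_iff_adj_or_eq.2 hxy)
  have hx' : (⟦x'⟧ : Quotient r) = ⟦x⟧ := Quotient.sound (r.symm hx)
  have hy' : (⟦y'⟧ : Quotient r) = ⟦y⟧ := Quotient.sound (r.symm hy)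
  by_contra hadj
  refine hfar (Or.inl ⟨fun heq => hfar (Or.inr heq), ?_⟩)
  by_cases hxy : G.Adj x y
  · exact ⟨⟨x, y, rfl, rfl, hxy⟩, x', y', hx', hy', fun h' => hadj (iff_of_true hxy h')⟩
  · exact ⟨⟨x', y', hx', hy', by_contra fun h' => hadj (iff_of_false hxy h')⟩, x, y, rfl, rfl, hxy⟩

end RedGraph

section Game

open SetRel

variable {V : Type u} {G : SimpleGraph V} {r s : Setoid V} {q : ℕ} {S T : SetRel V V}

/-- Duplicator wins the Ehrenfeucht–Fraïssé game of `q` rounds on two copies of `G`, each vertex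
coloured by its class, from the position in which the pairs in `S` have been played. -/
def Winning (G : SimpleGraph V) (r : Setoid V) : ℕ → SetRel V V → Prop
  | 0, S => ∀ x ∈ S, r x.1 x.2 ∧
      ∀ y ∈ S, (x.1 = y.1 ↔ x.2 = y.2) ∧ (G.Adj x.1 y.1 ↔ G.Adj x.2 y.2)
  | q + 1, S => Winning G r q S ∧ (∀ a, ∃ b, Winning G r q (insert (a, b) S)) ∧
      ∀ b, ∃ a, Winning G r q (insert (a, b) S)

lemma Winning.of_le {q' : ℕ} (h : Winning G r q' S) (hq : q ≤ q') : Winning G r q S := by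
  induction hq with
  | refl => exact h
  | step _ ih => exact ih h.1

lemma Winning.rel (h : Winning G r q S) {x : V × V} (hx : x ∈ S) : r x.1 x.2 :=
  (h.of_le (Nat.zero_le q) x hx).1

lemma Winning.rel_of_insert {a b : V} (h : Winning G r q (insert (a, b) S)) : r a b :=
  h.rel (Set.mem_insert (a, b) S)

lemma Winning.mono (h : Winning G r q T) (hST : S ⊆ T) : Winning G r q S := by
  induction q generalizing S T with
  | zero => exact fun x hx => ⟨(h x (hST hx)).1, fun y hy => (h x (hST hx)).2 y (hST hy)⟩
  | succ q ih =>
    exact ⟨ih h.1 hST,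
      fun a => (h.2.1 a).imp fun _ hb => ih hb (Set.insert_subset_insert hST),
      fun b => (h.2.2 b).imp fun _ ha => ih ha (Set.insert_subset_insert hST)⟩

lemma Winning.coarsen (hrs : r ≤ s) (h : Winning G r q S) : Winning G s q S := by
  induction q generalizing S with
  | zero => exact fun x hx => ⟨hrs (h x hx).1, (h x hx).2⟩
  | succ q ih =>
    exact ⟨ih h.1, fun a => (h.2.1 a).imp fun _ => ih, fun b => (h.2.2 b).imp fun _ => ih⟩

lemma winning_of_subset_id (q : ℕ) (h : S ⊆ SetRel.id) : Winning G r q S := by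
  induction q generalizing S with
  | zero =>
    rintro ⟨x, _⟩ hx
    obtain rfl : x = _ := h hx
    refine ⟨r.refl x, ?_⟩
    rintro ⟨y, _⟩ hy
    obtain rfl : y = _ := h hy
    exact ⟨Iff.rfl, Iff.rfl⟩
  | succ q ih =>
    have insert_diagonal : ∀ a, Winning G r q (insert (a, a) S) := fun a =>
      ih (Set.insert_subset (SetRel.mem_id.2 rfl) h)
    exact ⟨ih h, fun a => ⟨a, insert_diagonal a⟩, fun a => ⟨a, insert_diagonal a⟩⟩

lemma Winning.inv (h : Winning G r q S) : Winning G r q S.inv := by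
  induction q generalizing S with
  | zero =>
    refine fun x hx => ⟨r.symm (h _ hx).1, fun y hy => ?_⟩
    exact ⟨((h _ hx).2 _ hy).1.symm, ((h _ hx).2 _ hy).2.symm⟩
  | succ q ih =>
    have insert_inv : ∀ a b, insert (b, a) S.inv ⊆ SetRel.inv (insert (a, b) S) := by
      rintro a b _ (rfl | hx)
      · exact Or.inl rfl
      · exact Or.inr hx
    exact ⟨ih h.1,
      fun a => (h.2.2 a).imp fun b hb => (ih hb).mono (insert_inv b a),
      fun b => (h.2.1 b).imp fun a ha => (ih ha).mono (insert_inv b a)⟩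

lemma Winning.comp (hS : Winning G r q S) (hT : Winning G r q T) : Winning G r q (S ○ T) := by
  induction q generalizing S T with
  | zero =>
    rintro x ⟨c, hc, hc'⟩
    refine ⟨r.trans (hS _ hc).1 (hT _ hc').1, ?_⟩
    rintro y ⟨e, he, he'⟩
    exact ⟨((hS _ hc).2 _ he).1.trans ((hT _ hc').2 _ he').1,
      ((hS _ hc).2 _ he).2.trans ((hT _ hc').2 _ he').2⟩
  | succ q ih =>
    have insert_comp : ∀ a c b, insert (a, b) (S ○ T) ⊆ insert (a, c) S ○ insert (c, b) T := by
      rintro a c b _ (rfl | ⟨e, he, he'⟩)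
      · exact ⟨c, Or.inl rfl, Or.inl rfl⟩
      · exact ⟨e, Or.inr he, Or.inr he'⟩
    refine ⟨ih hS.1 hT.1, fun a => ?_, fun b => ?_⟩
    · obtain ⟨c, hc⟩ := hS.2.1 a
      obtain ⟨b, hb⟩ := hT.2.1 c
      exact ⟨b, (ih hc hb).mono (insert_comp a c b)⟩
    · obtain ⟨c, hc⟩ := hT.2.2 b
      obtain ⟨a, ha⟩ := hS.2.2 c
      exact ⟨a, (ih ha hc).mono (insert_comp a c b)⟩

lemma Winning.union_zero (hS : Winning G r 0 S) (hT : Winning G r 0 T)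
    (hST : ∀ x ∈ S, ∀ y ∈ T, 1 < redDist G r x.1 y.1) : Winning G r 0 (S ∪ T) := by
  have cross : ∀ x ∈ S, ∀ y ∈ T,
      (x.1 = y.1 ↔ x.2 = y.2) ∧ (G.Adj x.1 y.1 ↔ G.Adj x.2 y.2) := by
    intro x hx y hy
    have hx' := hS.rel hx
    have hy' := hT.rel hy
    have hxy : ¬r x.1 y.1 := fun h =>
      not_lt_zero (redDist_eq_zero.2 h ▸ hST x hx y hy)
    refine ⟨iff_of_false (fun h => hxy (h ▸ r.refl _)) fun h => hxy ?_,
      adj_congr_of_one_lt_redDist hx' hy' (hST x hx y hy)⟩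
    exact r.trans hx' (h ▸ r.symm hy')
  rintro x (hx | hx)
  · refine ⟨hS.rel hx, ?_⟩
    rintro y (hy | hy)
    · exact (hS x hx).2 y hy
    · exact cross x hx y hy
  · refine ⟨hT.rel hx, ?_⟩
    rintro y (hy | hy)
    · obtain ⟨h₁, h₂⟩ := cross y hy x hx
      exact ⟨by rw [eq_comm, h₁, eq_comm], by rw [G.adj_comm, h₂, G.adj_comm]⟩
    · exact (hT x hx).2 y hy

lemma lt_redDist_of_add_lt {m n : ℕ∞} {x y z : V} (h : m + n < redDist G r x z)
    (hxy : redDist G r x y ≤ m) : n < redDist G r y z := by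
  by_contra! hyz
  exact h.not_ge ((redDist_triangle x y z).trans (add_le_add hxy hyz))

lemma two_pow_add_self (q : ℕ) : (2 : ℕ∞) ^ q + 2 ^ q = 2 ^ (q + 1) := by
  rw [pow_succ, mul_two]

/-- Spoiler's move is answered in whichever of the two positions it is close to. -/
lemma Winning.union (hS : Winning G r q S) (hT : Winning G r q T)
    (hST : ∀ x ∈ S, ∀ y ∈ T, 2 ^ q < redDist G r x.1 y.1) : Winning G r q (S ∪ T) := by
  induction q generalizing S T with
  | zero => exact hS.union_zero hT (by simpa only [pow_zero] using hST)
  | succ q ih =>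
    simp only [← two_pow_add_self] at hST
    have far : ∀ x ∈ S, ∀ y ∈ T, 2 ^ q < redDist G r x.1 y.1 := fun x hx y hy =>
      le_self_add.trans_lt (hST x hx y hy)
    have near_S : ∀ a b, (∃ x ∈ S, redDist G r x.1 a ≤ 2 ^ q) →
        Winning G r q (insert (a, b) S) → Winning G r q (insert (a, b) (S ∪ T)) := by
      rintro a b ⟨x, hx, hxa⟩ h
      rw [← Set.insert_union]
      refine ih h hT.1 ?_
      rintro z (rfl | hz) y hy
      · exact lt_redDist_of_add_lt (hST x hx y hy) hxa
      · exact far z hz y hy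
    have far_S : ∀ a b, (¬∃ x ∈ S, redDist G r x.1 a ≤ 2 ^ q) →
        Winning G r q (insert (a, b) T) → Winning G r q (insert (a, b) (S ∪ T)) := by
      intro a b hx h
      rw [← Set.union_insert]
      refine ih hS.1 h ?_
      rintro z hz y (rfl | hy)
      · exact not_le.1 fun hn => hx ⟨z, hz, hn⟩
      · exact far z hz y hy
    refine ⟨ih hS.1 hT.1 far, fun a => ?_, fun b => ?_⟩
    · by_cases hx : ∃ x ∈ S, redDist G r x.1 a ≤ 2 ^ q
      · exact (hS.2.1 a).imp fun b => near_S a b hx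
      · exact (hT.2.1 a).imp fun b => far_S a b hx
    · by_cases hx : ∃ x ∈ S, redDist G r x.1 b ≤ 2 ^ q
      · refine (hS.2.2 b).imp fun a ha => near_S a b ?_ ha
        simpa only [redDist_congr (r.refl _) ha.rel_of_insert] using hx
      · refine (hT.2.2 b).imp fun a ha => far_S a b ?_ ha
        simpa only [redDist_congr (r.refl _) ha.rel_of_insert] using hx

lemma Winning.insert_self (h : Winning G r q S) {a : V}
    (ha : ∀ x ∈ S, 2 ^ q < redDist G r x.1 a) : Winning G r q (insert (a, a) S) := by
  rw [← Set.union_singleton]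
  refine h.union (winning_of_subset_id q (by simp)) ?_
  rintro x hx y rfl
  exact ha x hx

/-- Away from the only class of `s` that is not a class of `r`, the finer colouring comes for
free: Spoiler's moves far from the position are answered by copying them. -/
lemma Winning.refine_of_far {c : V} (hrs : r ≤ s) (hc : ∀ x y, s x y → r x y ∨ s x c)
    (h : Winning G s q S) (hS : ∀ x ∈ S, 2 ^ q < redDist G s c x.1) : Winning G r q S := by
  induction q generalizing S with
  | zero =>
    refine fun x hx => ⟨(hc _ _ (h x hx).1).resolve_right fun hxc => ?_, (h x hx).2⟩
    exact not_lt_zero (redDist_eq_zero.2 (s.symm hxc) ▸ hS x hx)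
  | succ q ih =>
    simp only [← two_pow_add_self] at hS
    have far : ∀ x ∈ S, 2 ^ q < redDist G s c x.1 := fun x hx => le_self_add.trans_lt (hS x hx)
    have h₀ := ih h.1 far
    have near_S : ∀ a b, (∃ x ∈ S, redDist G s x.1 a ≤ 2 ^ q) →
        Winning G s q (insert (a, b) S) → Winning G r q (insert (a, b) S) := by
      rintro a b ⟨x, hx, hxa⟩ h'
      refine ih h' ?_
      rintro z (rfl | hz)
      · rw [redDist_comm]
        exact lt_redDist_of_add_lt (redDist_comm c x.1 ▸ hS x hx) hxa
      · exact far z hz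
    have far_S : ∀ a, (¬∃ x ∈ S, redDist G s x.1 a ≤ 2 ^ q) →
        Winning G r q (insert (a, a) S) := by
      refine fun a ha => h₀.insert_self fun x hx => ?_
      exact (not_le.1 fun hn => ha ⟨x, hx, hn⟩).trans_le (redDist_anti hrs _ _)
    refine ⟨h₀, fun a => ?_, fun b => ?_⟩
    · by_cases ha : ∃ x ∈ S, redDist G s x.1 a ≤ 2 ^ q
      · exact (h.2.1 a).imp fun b => near_S a b ha
      · exact ⟨a, far_S a ha⟩
    · by_cases hb : ∃ x ∈ S, redDist G s x.1 b ≤ 2 ^ q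
      · refine (h.2.2 b).imp fun a ha => near_S a b ?_ ha
        simpa only [redDist_congr (s.refl _) ha.rel_of_insert] using hb
      · exact ⟨b, far_S b hb⟩

end Game

section GameEquiv

open SetRel

variable {V : Type u} {κ : Type w} {G : SimpleGraph V} {r s : Setoid V} {q : ℕ} {x y z : κ → V}
  {D E : Set κ}

/-- The position matching the entries of two tuples whose indices lie in `D`. -/
def pairs (x y : κ → V) (D : Set κ) : SetRel V V := (fun i => (x i, y i)) '' D

/-- The restrictions of two tuples to the indices in `D` cannot be told apart in the coloured
game of `q` rounds. -/
def GameEquiv (G : SimpleGraph V) (r : Setoid V) (q : ℕ) (D : Set κ) (x y : κ → V) : Prop :=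
  Winning G r q (pairs x y D)

namespace GameEquiv

lemma of_eqOn (h : Set.EqOn x y D) : GameEquiv G r q D x y :=
  winning_of_subset_id q (Set.image_subset_iff.2 fun _ hi => h hi)

lemma refl (x : κ → V) : GameEquiv G r q D x x :=
  of_eqOn (Set.eqOn_refl x D)

lemma mono (h : GameEquiv G r q D x y) (hE : E ⊆ D) : GameEquiv G r q E x y :=
  Winning.mono h (Set.image_mono hE)

lemma of_le {q' : ℕ} (h : GameEquiv G r q' D x y) (hq : q ≤ q') : GameEquiv G r q D x y :=
  Winning.of_le h hq

lemma symm (h : GameEquiv G r q D x y) : GameEquiv G r q D y x := by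
  refine (Winning.inv h).mono ?_
  rintro _ ⟨i, hi, rfl⟩
  exact ⟨i, hi, rfl⟩

lemma trans (h : GameEquiv G r q D x y) (h' : GameEquiv G r q D y z) :
    GameEquiv G r q D x z := by
  refine (Winning.comp h h').mono ?_
  rintro _ ⟨i, hi, rfl⟩
  exact ⟨y i, ⟨i, hi, rfl⟩, ⟨i, hi, rfl⟩⟩

lemma rel (h : GameEquiv G r q D x y) {i : κ} (hi : i ∈ D) : r (x i) (y i) :=
  Winning.rel h (Set.mem_image_of_mem (fun i => (x i, y i)) hi)

lemma coarsen (hrs : r ≤ s) (h : GameEquiv G r q D x y) : GameEquiv G s q D x y :=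
  Winning.coarsen hrs h

lemma refine_of_far {c : V} (hrs : r ≤ s) (hc : ∀ x y, s x y → r x y ∨ s x c)
    (h : GameEquiv G s q D x y) (hD : ∀ i ∈ D, 2 ^ q < redDist G s c (x i)) :
    GameEquiv G r q D x y := by
  refine Winning.refine_of_far hrs hc h ?_
  rintro _ ⟨i, hi, rfl⟩
  exact hD i hi

lemma union (hD : GameEquiv G r q D x y) (hE : GameEquiv G r q E x y)
    (h : ∀ i ∈ D, ∀ j ∈ E, 2 ^ q < redDist G r (x i) (x j)) : GameEquiv G r q (D ∪ E) x y := by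
  rw [GameEquiv, pairs, Set.image_union]
  refine Winning.union hD hE ?_
  rintro _ ⟨i, hi, rfl⟩ _ ⟨j, hj, rfl⟩
  exact h i hi j hj

lemma of_gap {l : ℕ∞} {c : V}
    (hgap : ∀ i ∈ D, redDist G r c (x i) ≤ l + 2 ^ q → redDist G r c (x i) ≤ l)
    (hin : GameEquiv G r q {i ∈ D | redDist G r c (x i) ≤ l} x y)
    (hout : GameEquiv G r q {i ∈ D | ¬redDist G r c (x i) ≤ l} x y) : GameEquiv G r q D x y := by
  refine (hin.union hout ?_).mono fun i hi => ?_
  · rintro i ⟨-, hi⟩ j ⟨hj, hj'⟩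
    exact lt_redDist_of_add_lt (not_le.1 (mt (hgap j hj) hj')) hi
  · exact (em (redDist G r c (x i) ≤ l)).imp (fun h => ⟨hi, h⟩) fun h => ⟨hi, h⟩

end GameEquiv

lemma exists_redDist_gap [Finite κ] (G : SimpleGraph V) (r : Setoid V) (q : ℕ) (c : V)
    (x : κ → V) : ∃ l ≤ Nat.card κ,
      ∀ i, redDist G r c (x i) ≤ l * 2 ^ q + 2 ^ q → redDist G r c (x i) ≤ l * 2 ^ q := by
  have hmono : Monotone fun l : ℕ => (l * 2 ^ q : ℕ∞) := fun l m h => by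
    dsimp only
    gcongr
  simpa only [Nat.cast_add, Nat.cast_one, add_mul, one_mul] using
    exists_gap hmono fun i => redDist G r c (x i)

lemma exists_local_of_not_gameEquiv [Finite κ] (h : ¬GameEquiv G r q D x y) :
    ∃ E ⊆ D, ∃ i ∈ E, ¬GameEquiv G r q E x y ∧
      ∀ j ∈ E, redDist G r (x i) (x j) ≤ Nat.card κ * 2 ^ q := by
  obtain ⟨E, hED, hE⟩ := exists_minimal_le_of_wellFoundedLT (¬GameEquiv G r q · x y) D h
  obtain ⟨i, hi⟩ : E.Nonempty := by
    rw [Set.nonempty_iff_ne_empty]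
    rintro rfl
    exact hE.prop (GameEquiv.of_eqOn (Set.eqOn_empty x y))
  refine ⟨E, hED, i, hi, hE.prop, fun j hj => ?_⟩
  obtain ⟨l, hl, hgap⟩ := exists_redDist_gap G r q (x i) x
  have hout : GameEquiv G r q {j ∈ E | ¬redDist G r (x i) (x j) ≤ l * 2 ^ q} x y := by
    by_contra hlose
    exact (hE.le_of_le hlose (Set.sep_subset _ _) hi).2 (by simp [redDist_eq_zero.2 (r.refl _)])
  have hin : ¬GameEquiv G r q {j ∈ E | redDist G r (x i) (x j) ≤ l * 2 ^ q} x y :=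
    fun hin => hE.prop (GameEquiv.of_gap (fun j _ => hgap j) hin hout)
  refine (hE.le_of_le hin (Set.sep_subset _ _) hj).2.trans ?_
  gcongr

end GameEquiv

section Code

variable {V : Type u} {κ : Type w} {G : SimpleGraph V} {r : Setoid V} {q d : ℕ} {x y : κ → V}

lemma GameEquiv.succ (h : GameEquiv G r q Set.univ x y)
    (forth : ∀ a, ∃ b,
      GameEquiv G r q Set.univ (fun o : Option κ => o.elim a x) (fun o => o.elim b y))
    (back : ∀ b, ∃ a,
      GameEquiv G r q Set.univ (fun o : Option κ => o.elim b y) (fun o => o.elim a x)) :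
    GameEquiv G r (q + 1) Set.univ x y := by
  have insert_pairs : ∀ a b, insert (a, b) (pairs x y Set.univ) ⊆
      pairs (fun o : Option κ => o.elim a x) (fun o => o.elim b y) Set.univ := by
    rintro a b _ (rfl | ⟨i, -, rfl⟩)
    · exact ⟨none, trivial, rfl⟩
    · exact ⟨some i, trivial, rfl⟩
  exact ⟨h, fun a => (forth a).imp fun b hb => Winning.mono hb (insert_pairs a b),
    fun b => (back b).imp fun a ha => Winning.mono ha.symm (insert_pairs a b)⟩

lemma GameEquiv.elim_self (h : GameEquiv G r q Set.univ x y) {a : V}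
    (ha : ∀ i, 2 ^ q < redDist G r (x i) a) :
    GameEquiv G r q Set.univ (fun o : Option κ => o.elim a x) (fun o => o.elim a y) := by
  refine (Winning.insert_self h (a := a) ?_).mono ?_
  · rintro _ ⟨i, -, rfl⟩
    exact ha i
  · rintro _ ⟨_ | i, -, rfl⟩
    · exact Or.inl rfl
    · exact Or.inr ⟨i, trivial, rfl⟩

lemma exists_code_zero (κ : Type w) [Finite κ] : ∃ (Z : Type w) (_ : Finite Z),
    ∀ {V : Type u} (G : SimpleGraph V) (r : Setoid V), ∃ f : (κ → V) → Z,
      ∀ x y, (∀ i, r (x i) (y i)) → f x = f y → GameEquiv G r 0 Set.univ x y := by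
  refine ⟨κ → κ → Prop × Prop, inferInstance, fun G r =>
    ⟨fun x i j => (x i = x j, G.Adj (x i) (x j)), fun x y hxy hf => ?_⟩⟩
  rintro _ ⟨i, -, rfl⟩
  refine ⟨hxy i, ?_⟩
  rintro _ ⟨j, -, rfl⟩
  simpa using congrFun₂ hf i j

lemma RedDegreeLE.exists_labels [Finite κ] (hd : RedDegreeLE G r d) (ρ : ℕ) (c : κ → Quotient r) :
    ∃ g : Quotient r → Fin (Nat.card κ * (d + 1) ^ ρ + 1),
      Set.InjOn g {b | ∃ i, (redGraph G r).edist (c i) b ≤ ρ} := by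
  refine exists_injOn_fin ?_
  have hunion : {b | ∃ i, (redGraph G r).edist (c i) b ≤ ρ} =
      ⋃ i ∈ (Set.univ : Set κ), {b | (redGraph G r).edist (c i) b ≤ ρ} := by
    ext
    simp
  rw [hunion]
  refine (encard_biUnion_le_mul fun i _ => hd.encard_ball_le ρ (c i)).trans_eq ?_
  rw [Set.encard_univ, ENat.card_eq_coe_natCard, ← Nat.cast_mul]

/-- A move near the tuple is described by a label of the class it is played in together with the
code of the tuple it leads to; moves far from the tuple need no description. -/
lemma exists_code_univ (d q : ℕ) (κ : Type w) [Finite κ] : ∃ (Z : Type w) (_ : Finite Z),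
    ∀ {V : Type u} {G : SimpleGraph V} {r : Setoid V}, RedDegreeLE G r d →
      ∃ f : (κ → V) → Z, ∀ x y, (∀ i, r (x i) (y i)) → f x = f y →
        GameEquiv G r q Set.univ x y := by
  induction q generalizing κ with
  | zero =>
    obtain ⟨Z, hZ, h⟩ := exists_code_zero.{u} κ
    exact ⟨Z, hZ, fun _ => h _ _⟩
  | succ q ih =>
    obtain ⟨Z₀, _, code₀⟩ := ih κ
    obtain ⟨Z₁, _, code₁⟩ := ih (Option κ)
    refine ⟨Z₀ × Set (Fin (Nat.card κ * (d + 1) ^ 2 ^ q + 1) × Z₁), inferInstance,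
      fun {V G r} hd => ?_⟩
    obtain ⟨f₀, hf₀⟩ := code₀ hd
    obtain ⟨f₁, hf₁⟩ := code₁ hd
    choose g hg using hd.exists_labels (κ := κ) (2 ^ q)
    let nearMoves (x : κ → V) : Set (Fin (Nat.card κ * (d + 1) ^ 2 ^ q + 1) × Z₁) :=
      (fun a => (g (fun i => ⟦x i⟧) ⟦a⟧, f₁ fun o => o.elim a x)) ''
        {a | ∃ i, redDist G r (x i) a ≤ (2 ^ q : ℕ)}
    have forth : ∀ x y, (∀ i, r (x i) (y i)) → f₀ x = f₀ y → nearMoves x = nearMoves y → ∀ a,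
        ∃ b, GameEquiv G r q Set.univ (fun o : Option κ => o.elim a x) (fun o => o.elim b y) := by
      intro x y hxy h₀ h₁ a
      by_cases ha : ∃ i, redDist G r (x i) a ≤ (2 ^ q : ℕ)
      · have hcol : (fun i => (⟦y i⟧ : Quotient r)) = fun i => ⟦x i⟧ :=
          funext fun i => Quotient.sound (r.symm (hxy i))
        have hmove : (g (fun i => ⟦x i⟧) ⟦a⟧, f₁ fun o => o.elim a x) ∈ nearMoves y :=
          h₁ ▸ Set.mem_image_of_mem _ ha
        obtain ⟨b, ⟨i, hi⟩, hab⟩ := hmove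
        rw [Prod.mk.injEq, hcol] at hab
        have hi' : redDist G r (x i) b ≤ (2 ^ q : ℕ) := redDist_congr (hxy i) (r.refl b) ▸ hi
        refine ⟨b, hf₁ _ _ (Option.rec ?_ hxy) hab.2.symm⟩
        exact Quotient.exact (hg _ ha ⟨i, hi'⟩ hab.1.symm)
      · push Not at ha
        exact ⟨a, (hf₀ x y hxy h₀).elim_self (by exact_mod_cast ha)⟩
    refine ⟨fun x => (f₀ x, nearMoves x), fun x y hxy hf => ?_⟩
    obtain ⟨h₀, h₁⟩ := Prod.mk.inj hf
    exact (hf₀ x y hxy h₀).succ (forth x y hxy h₀ h₁)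
      (forth y x (fun i => r.symm (hxy i)) h₀.symm h₁.symm)

lemma exists_code (d q : ℕ) (κ : Type w) [Finite κ] : ∃ (Z : Type w) (_ : Finite Z),
    ∀ {V : Type u} {G : SimpleGraph V} {r : Setoid V}, RedDegreeLE G r d →
      ∃ f : Set κ → (κ → V) → Z, ∀ D x y, (∀ i ∈ D, r (x i) (y i)) → f D x = f D y →
        GameEquiv G r q D x y := by
  choose Z hZ code using fun D : Set κ => exists_code_univ.{u} d q D
  refine ⟨Σ D, Z D, inferInstance, fun {V G r} hd => ?_⟩
  choose f hf using fun D => code D hd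
  refine ⟨fun D x => ⟨D, f D fun i => x i⟩, fun D x y hxy h => ?_⟩
  refine Winning.mono (hf D _ _ (fun i => hxy i i.2) (eq_of_heq (Sigma.mk.inj h).2)) ?_
  rintro _ ⟨i, hi, rfl⟩
  exact ⟨⟨i, hi⟩, trivial, rfl⟩

lemma exists_code_ball (d q ρ : ℕ) (κ : Type w) [Finite κ] : ∃ (Z : Type w) (_ : Finite Z),
    ∀ {V : Type u} {G : SimpleGraph V} {r : Setoid V}, RedDegreeLE G r d → ∀ v : V,
      ∃ f : Set κ → (κ → V) → Z, ∀ D x y, (∀ i ∈ D, redDist G r v (x i) ≤ ρ) →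
        (∀ i ∈ D, redDist G r v (y i) ≤ ρ) → f D x = f D y → GameEquiv G r q D x y := by
  obtain ⟨Z, _, code⟩ := exists_code.{u} d q κ
  refine ⟨(κ → Fin ((d + 1) ^ ρ + 1)) × Z, inferInstance, fun {V G r} hd v => ?_⟩
  obtain ⟨f, hf⟩ := code hd
  obtain ⟨g, hg⟩ := exists_injOn_fin (hd.encard_ball_le ρ ⟦v⟧)
  refine ⟨fun D x => (fun i => g ⟦x i⟧, f D x), fun D x y hx hy hxy => ?_⟩
  obtain ⟨hlabel, hcode⟩ := Prod.mk.inj hxy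
  exact hf D x y (fun i hi => Quotient.exact (hg (hx i hi) (hy i hi) (congrFun hlabel i))) hcode

end Code

section MergeSequence

variable {V : Type u} {G : SimpleGraph V} {d : ℕ} {r : ℕ → Setoid V}

/-- A contraction sequence of width at most `d`, seen as a sequence of equivalence relations that
becomes stationary and in which a step merges at most two classes. -/
structure IsMergeSequence (G : SimpleGraph V) (d : ℕ) (r : ℕ → Setoid V) : Prop where
  zero : r 0 = ⊥
  mono : Monotone r
  exists_merge : ∀ t, ∃ a b, ∀ x y, r (t + 1) x y → r t x y ∨ r (t + 1) x a ∧ (r t x a ∨ r t x b)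
  redDegreeLE : ∀ t, RedDegreeLE G (r t) d
  exists_eq_top : ∃ N, r N = ⊤

lemma IsMergeSequence.exists_center (h : IsMergeSequence G d r) (t : ℕ) :
    ∃ c, (∀ x y, r (t + 1) x y → r t x y ∨ r (t + 1) x c) ∧ ∀ n : ℕ,
      (Quotient.mk (r t) '' {x | redDist G (r (t + 1)) c x ≤ n}).encard ≤
        ((d + 1) ^ n + 2 : ℕ) := by
  obtain ⟨a, b, hab⟩ := h.exists_merge t
  refine ⟨a, fun x y hxy => (hab x y hxy).imp_right And.left, fun n => ?_⟩
  set ball := {k | (redGraph G (r (t + 1))).edist ⟦a⟧ k ≤ n}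
  have hsub : Quotient.mk (r t) '' {x | redDist G (r (t + 1)) a x ≤ n} ⊆
      insert ⟦a⟧ (insert ⟦b⟧ ((fun k => ⟦k.out⟧) '' ball)) := by
    rintro _ ⟨x, hx, rfl⟩
    have hout : r (t + 1) x (⟦x⟧ : Quotient (r (t + 1))).out :=
      (r (t + 1)).symm (Quotient.mk_out x)
    rcases hab _ _ hout with hxk | ⟨-, hxa | hxb⟩
    · exact .inr (.inr ⟨⟦x⟧, hx, (Quotient.sound hxk).symm⟩)
    · exact .inl (Quotient.sound hxa)
    · exact .inr (.inl (Quotient.sound hxb))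
  calc _ ≤ _ := Set.encard_le_encard hsub
    _ ≤ ball.encard + 1 + 1 := by
      refine (Set.encard_insert_le _ _).trans (add_le_add_left ?_ 1)
      exact (Set.encard_insert_le _ _).trans (add_le_add_left (Set.encard_image_le _ _) 1)
    _ ≤ ((d + 1) ^ n : ℕ) + 1 + 1 := by
      gcongr
      exact (h.redDegreeLE (t + 1)).encard_ball_le n ⟦a⟧
    _ = _ := by rw [add_assoc, one_add_one_eq_two]; rfl

end MergeSequence

section Events

variable {V : Type u} {κ : Type w} {G : SimpleGraph V} {d q : ℕ} {r : ℕ → Setoid V}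
  {B : Set V} {D E : Set κ}

/-- The times at which two classes of `r` that meet `B` are merged. -/
def mergeTimes (r : ℕ → Setoid V) (B : Set V) : Set ℕ :=
  {t | ∃ x ∈ B, ∃ y ∈ B, r (t + 1) x y ∧ ¬r t x y}

/-- The times at which two tuples with entries in the sets `P i`, for `i ∈ D`, become equivalent in
the game of `q` rounds. -/
def eventTimes (G : SimpleGraph V) (r : ℕ → Setoid V) (q : ℕ) (D : Set κ) (P : κ → Set V) : Set ℕ :=
  {t | ∃ x y, (∀ i ∈ D, x i ∈ P i ∧ y i ∈ P i) ∧ GameEquiv G (r (t + 1)) q D x y ∧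
    ¬GameEquiv G (r t) q D x y}

lemma encard_setOf_ne_succ_le_of_code {α : Type u} {Z : Type v} [Finite Z] {R : ℕ → Setoid α}
    (hR : Monotone R) {T : Set ℕ}
    (hT : ∀ t ∈ T, R t ≠ R (t + 1) ∧ ∃ f : α → Z, ∀ x y, f x = f y → R t x y) :
    T.encard ≤ Nat.card Z := by
  refine (Set.encard_le_encard fun t ht => ?_).trans (encard_setOf_ne_succ_le hR (Nat.card Z))
  obtain ⟨hne, f, hf⟩ := hT t ht
  refine ⟨?_, hne⟩
  rw [← ENat.card_eq_coe_natCard]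
  refine ENat.card_le_card_of_injective (f := fun a : Quotient (R t) => f a.out) fun a b hab => ?_
  exact Quotient.out_equiv_out.1 (hf _ _ hab)

lemma encard_mergeTimes_le (hr : Monotone r) : (mergeTimes r B).encard ≤ B.encard := by
  rcases B.finite_or_infinite with hB | hB
  swap
  · exact hB.encard_eq ▸ le_top
  have := hB.to_subtype
  rw [← ENat.card_coe_set_eq B, ENat.card_eq_coe_natCard]
  refine encard_setOf_ne_succ_le_of_code (R := fun t => (r t).comap ((↑) : B → V))
    (fun s t hst _ _ hxy => hr hst hxy) ?_
  rintro t ⟨x, hx, y, hy, hxy, hnxy⟩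
  refine ⟨fun heq => hnxy ?_, id, fun x y hxy => ?_⟩
  · exact (Setoid.ext_iff.1 heq ⟨x, hx⟩ ⟨y, hy⟩).2 hxy
  · obtain rfl : x = y := hxy
    exact (r t).refl _

/-- Equivalence of tuples in the game of `q` rounds played on the indices in `D`. -/
def gameSetoid (G : SimpleGraph V) (r : Setoid V) (q : ℕ) (D : Set κ) : Setoid (κ → V) where
  r := GameEquiv G r q D
  iseqv := ⟨GameEquiv.refl, GameEquiv.symm, GameEquiv.trans⟩

lemma encard_eventTimes_inter_le (hr : Monotone r) {Z : Type v} [Finite Z] {P : κ → Set V}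
    (code : ∀ t, ∃ f : (κ → V) → Z, ∀ x y, (∀ i ∈ D, r t (x i) (y i)) → f x = f y →
      GameEquiv G (r t) q D x y) :
    (eventTimes G r q D P ∩ {t | ∀ i ∈ D, ∀ a ∈ P i, ∀ b ∈ P i, r t a b}).encard ≤ Nat.card Z := by
  refine encard_setOf_ne_succ_le_of_code (α := {x : κ → V // ∀ i ∈ D, x i ∈ P i})
    (R := fun t => (gameSetoid G (r t) q D).comap (↑))
    (fun s t hst x y => GameEquiv.coarsen (hr hst)) ?_
  rintro t ⟨⟨x, y, hxy, hw, hn⟩, hP⟩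
  refine ⟨fun heq => hn ?_, ?_⟩
  · exact (Setoid.ext_iff.1 heq ⟨x, fun i hi => (hxy i hi).1⟩
      ⟨y, fun i hi => (hxy i hi).2⟩).2 hw
  · obtain ⟨f, hf⟩ := code t
    exact ⟨fun x => f x, fun x y => hf x y fun i hi => hP i hi _ (x.2 i hi) _ (y.2 i hi)⟩

/-- The times at which tuples become equivalent that have their entries in `B` and in classes of
`r e` close to the class of `c`, and whose classes within `B` do not change until the time `e`. -/
def localEventTimes (κ : Type w) (G : SimpleGraph V) (r : ℕ → Setoid V) (q : ℕ) (B : Set V) (c : V)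
    (e : ℕ) : Set ℕ :=
  ⋃ E : Set κ, ⋃ C ∈ Set.pi Set.univ fun _ : κ =>
      Quotient.mk (r e) '' {x | redDist G (r (e + 1)) c x ≤ (2 * (Nat.card κ * 2 ^ q) : ℕ)},
    eventTimes G r q E (fun i => {b ∈ B | ⟦b⟧ = C i}) ∩
      {t | ∀ i ∈ E, ∀ a ∈ {b ∈ B | ⟦b⟧ = C i}, ∀ b ∈ {b ∈ B | ⟦b⟧ = C i}, r t a b}

/-- `e` is the first time at which a vertex of the tuple gets close to a merge that concerns `B`. -/
lemma exists_stable_until {c : ℕ → V} {N t : ℕ} {x : κ → V} {i₀ : κ}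
    (hc : ∀ t x y, r (t + 1) x y → r t x y ∨ r (t + 1) x (c t)) (hN : r (N + 1) = ⊤) (htN : t ≤ N)
    (hi₀ : i₀ ∈ E) (hxB : ∀ i ∈ E, x i ∈ B) :
    ∃ e ∈ insert N (mergeTimes r B), t ≤ e ∧ (∃ i ∈ E, r (e + 1) (x i) (c e)) ∧
      ∀ i ∈ E, ∀ b ∈ B, r e b (x i) → r t b (x i) := by
  have hex : ∃ e, t ≤ e ∧ e ∈ insert N (mergeTimes r B) ∧ ∃ i ∈ E, r (e + 1) (x i) (c e) :=
    ⟨N, htN, Set.mem_insert _ _, i₀, hi₀, by rw [hN]; trivial⟩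
  classical
  obtain ⟨hte, he, hi⟩ := Nat.find_spec hex
  refine ⟨Nat.find hex, he, hte, hi, fun i hi b hb => ?_⟩
  refine Nat.decreasingInduction' (P := fun s => r s b (x i)) (fun s hs hts hsucc => ?_) hte
  by_contra hns
  refine Nat.find_min hex hs ⟨hts, .inr ⟨b, hb, x i, hxB i hi, hsucc, hns⟩, i, hi, ?_⟩
  exact (r (s + 1)).trans ((r (s + 1)).symm hsucc) ((hc s _ _ hsucc).resolve_left hns)

/-- Tuples becoming equivalent at time `t` differ on a local set `E` of indices, which stays intact
until a time `e` of merging in `B` takes place close to it. -/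
lemma exists_mem_localEventTimes [Finite κ] (hr : Monotone r) {c : ℕ → V} {N t : ℕ}
    (hc : ∀ t x y, r (t + 1) x y → r t x y ∨ r (t + 1) x (c t)) (hN : r N = ⊤)
    (ht : t ∈ eventTimes G r q D fun _ => B) (htB : t ∉ mergeTimes r B) :
    ∃ e ∈ insert N (mergeTimes r B), t ∈ localEventTimes κ G r q B (c e) e := by
  obtain ⟨x, y, hxy, hw, hn⟩ := ht
  have htN : t ≤ N := by
    by_contra! hlt
    refine hn (hw.coarsen ?_)
    rw [top_le_iff.1 (hN ▸ hr hlt.le : ⊤ ≤ r t)]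
    exact le_top
  have hNsucc : r (N + 1) = ⊤ := top_le_iff.1 (hN ▸ hr N.le_succ)
  have hcol : ∀ i ∈ D, r t (x i) (y i) := fun i hi =>
    by_contra fun hne => htB ⟨x i, (hxy i hi).1, y i, (hxy i hi).2, hw.rel hi, hne⟩
  obtain ⟨E, hED, i₀, hi₀, hnE, hnear⟩ := exists_local_of_not_gameEquiv hn
  obtain ⟨e, he, hte, ⟨i, hi, hic⟩, hst⟩ :=
    exists_stable_until hc hNsucc htN hi₀ fun i hi => (hxy i (hED hi)).1
  have hmem : ∀ j ∈ E, redDist G (r (e + 1)) (c e) (x j) ≤ (2 * (Nat.card κ * 2 ^ q) : ℕ) := by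
    intro j hj
    calc redDist G (r (e + 1)) (c e) (x j) = redDist G (r (e + 1)) (x i) (x j) :=
          redDist_congr ((r (e + 1)).symm hic) ((r (e + 1)).refl _)
      _ ≤ redDist G (r t) (x i) (x j) := redDist_anti (hr (hte.trans e.le_succ)) _ _
      _ ≤ redDist G (r t) (x i₀) (x i) + redDist G (r t) (x i₀) (x j) :=
          redDist_comm (x i₀) (x i) ▸ redDist_triangle _ _ _
      _ ≤ Nat.card κ * 2 ^ q + Nat.card κ * 2 ^ q := add_le_add (hnear i hi) (hnear j hj)
      _ = _ := by push_cast; rw [two_mul]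
  classical
  have hxC : ∀ j ∈ E, ∀ a, (⟦a⟧ : Quotient (r e)) = ⟦if j ∈ E then x j else x i⟧ ↔ r e a (x j) :=
    fun j hj a => by rw [if_pos hj, Quotient.eq]
  have hstC : ∀ j ∈ E, ∀ a ∈ B, (⟦a⟧ : Quotient (r e)) = ⟦if j ∈ E then x j else x i⟧ →
      r t a (x j) := fun j hj a ha haC => hst j hj a ha ((hxC j hj a).1 haC)
  refine ⟨e, he, Set.mem_iUnion_of_mem E (Set.mem_biUnion (fun j _ => ⟨_, ?_, rfl⟩)
    ⟨⟨x, y, fun j hj => ⟨⟨(hxy j (hED hj)).1, ?_⟩, (hxy j (hED hj)).2, ?_⟩, hw.mono hED, hnE⟩,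
    fun j hj a ha b hb => (r t).trans (hstC j hj a ha.1 ha.2)
      ((r t).symm (hstC j hj b hb.1 hb.2))⟩)⟩
  · split_ifs with hj
    exacts [hmem j hj, hmem i hi]
  · exact (hxC j hj _).2 ((r e).refl _)
  · exact (hxC j hj _).2 ((r e).symm (hr hte (hcol j (hED hj))))

lemma exists_encard_localEventTimes_le (d q : ℕ) (κ : Type w) [Finite κ] : ∃ K : ℕ,
    ∀ {V : Type u} {G : SimpleGraph V} {r : ℕ → Setoid V}, Monotone r →
      (∀ t, RedDegreeLE G (r t) d) → ∀ {B : Set V} {c : V} {e : ℕ},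
        (∀ n : ℕ, (Quotient.mk (r e) '' {x | redDist G (r (e + 1)) c x ≤ n}).encard ≤
          ((d + 1) ^ n + 2 : ℕ)) → (localEventTimes κ G r q B c e).encard ≤ K := by
  obtain ⟨Z, _, code⟩ := exists_code.{u} d q κ
  let L := (d + 1) ^ (2 * (Nat.card κ * 2 ^ q)) + 2
  refine ⟨Nat.card (Set κ) * (L ^ Nat.card κ * Nat.card Z), fun {V G r} hr hd {B c e} hball => ?_⟩
  choose f hf using fun t => code (hd t)
  have hclasses : (Set.pi Set.univ fun _ : κ => Quotient.mk (r e) ''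
      {x | redDist G (r (e + 1)) c x ≤ (2 * (Nat.card κ * 2 ^ q) : ℕ)}).encard ≤
        (L ^ Nat.card κ : ℕ) := by
    exact_mod_cast encard_pi_univ_le fun _ => hball _
  rw [localEventTimes, ← Set.biUnion_univ]
  refine (encard_biUnion_le_mul fun E _ =>
    (encard_biUnion_le_mul fun C _ =>
      encard_eventTimes_inter_le hr fun t => ⟨f t E, hf t E⟩).trans
        (mul_le_mul_left hclasses _)).trans_eq ?_
  rw [Set.encard_univ, ENat.card_eq_coe_natCard]
  norm_cast

lemma exists_encard_eventTimes_le (d q : ℕ) (κ : Type w) [Finite κ] : ∃ K : ℕ,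
    ∀ {V : Type u} {G : SimpleGraph V} {r : ℕ → Setoid V}, IsMergeSequence G d r →
      ∀ {B : Set V}, B.Nonempty →
        (⋃ D : Set κ, eventTimes G r q D fun _ => B).encard ≤ K * B.encard := by
  obtain ⟨M, hM⟩ := exists_encard_localEventTimes_le.{u} d q κ
  refine ⟨1 + 2 * M, fun {V G r} h B hB => ?_⟩
  obtain ⟨N, hN⟩ := h.exists_eq_top
  choose c hc hball using h.exists_center
  have hcover : ⋃ D : Set κ, eventTimes G r q D (fun _ => B) ⊆ mergeTimes r B ∪
      ⋃ e ∈ insert N (mergeTimes r B), localEventTimes κ G r q B (c e) e := by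
    refine Set.iUnion_subset fun D t ht => or_iff_not_imp_left.2 fun htB => ?_
    obtain ⟨e, he, hte⟩ := exists_mem_localEventTimes h.mono hc hN ht htB
    exact Set.mem_biUnion he hte
  have hmerge := encard_mergeTimes_le (B := B) h.mono
  have htimes : (insert N (mergeTimes r B)).encard ≤ 2 * B.encard := by
    calc _ ≤ (mergeTimes r B).encard + 1 := Set.encard_insert_le _ _
      _ ≤ B.encard + B.encard := add_le_add hmerge (Set.one_le_encard_iff_nonempty.2 hB)
      _ = _ := (two_mul _).symm
  calc _ ≤ _ := (Set.encard_le_encard hcover).trans (Set.encard_union_le _ _)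
    _ ≤ B.encard + 2 * B.encard * M := add_le_add hmerge
      ((encard_biUnion_le_mul fun e _ => hM h.mono h.redDegreeLE (hball e)).trans
        (mul_le_mul_left htimes _))
    _ = _ := by push_cast; ring

end Events

section Traces

variable {V : Type u} {μ : Type v} {κ : Type w} {G : SimpleGraph V} {r s : Setoid V} {q : ℕ}
  {A : Set V} {J : Set κ} {x y : μ → V} {b c : κ → V} {D D' : Set (μ ⊕ κ)}

/-- The part of the tuple `(x, b)` indexed by `D` consists of elements of `A`, taken from `x`, and
of entries of `b` with an index in `J`. -/
def Supported (A : Set V) (J : Set κ) (x : μ → V) (D : Set (μ ⊕ κ)) : Prop :=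
  (∀ i, Sum.inl i ∈ D → x i ∈ A) ∧ ∀ j, Sum.inr j ∈ D → j ∈ J

/-- The subtuples of `b` and `c` indexed by `J` are interchangeable in the game of `q` rounds in the
presence of any tuple `x` of elements of `A`. -/
def SameTrace (μ : Type v) (G : SimpleGraph V) (r : Setoid V) (q : ℕ) (A : Set V) (J : Set κ)
    (b c : κ → V) : Prop :=
  ∀ (x : μ → V) (D : Set (μ ⊕ κ)), Supported A J x D →
    GameEquiv G r q D (Sum.elim x b) (Sum.elim x c)

/-- The entries of `b` indexed by `J` form a base of `b`: two tuples of elements of `A` that are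
equivalent over them are equivalent over `b`. -/
def IsBase (μ : Type v) (G : SimpleGraph V) (r : Setoid V) (q : ℕ) (A : Set V) (J : Set κ)
    (b : κ → V) : Prop :=
  ∀ (x y : μ → V) (D : Set (μ ⊕ κ)), Supported A J x D → Supported A J y D →
    GameEquiv G r q D (Sum.elim x b) (Sum.elim y b) →
      GameEquiv G r q (D ∪ Sum.inr '' Jᶜ) (Sum.elim x b) (Sum.elim y b)

lemma Supported.mono (h : Supported A J x D) (hD : D' ⊆ D) : Supported A J x D' :=
  ⟨fun i hi => h.1 i (hD hi), fun j hj => h.2 j (hD hj)⟩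

lemma Supported.diff {J' : Set κ} (h : Supported A J' x D) :
    Supported A J x (D \ Sum.inr '' Jᶜ) :=
  ⟨fun i hi => h.1 i hi.1, fun j hj => by_contra fun hjJ => hj.2 ⟨j, hjJ, rfl⟩⟩

lemma Supported.of_insert {i : κ} (h : Supported A (insert i J) x D) (hi : Sum.inr i ∉ D) :
    Supported A J x D :=
  ⟨h.1, fun j hj => (h.2 j hj).resolve_left fun hij => hi (hij ▸ hj)⟩

namespace SameTrace

lemma symm (h : SameTrace μ G r q A J b c) : SameTrace μ G r q A J c b :=
  fun x D hx => (h x D hx).symm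

lemma trans {e : κ → V} (h : SameTrace μ G r q A J b c) (h' : SameTrace μ G r q A J c e) :
    SameTrace μ G r q A J b e :=
  fun x D hx => (h x D hx).trans (h' x D hx)

lemma coarsen (hrs : r ≤ s) (h : SameTrace μ G r q A J b c) : SameTrace μ G s q A J b c :=
  fun x D hx => (h x D hx).coarsen hrs

lemma transfer (h : SameTrace μ G r q A J b c) (hx : Supported A J x D) (hy : Supported A J y D)
    (hxy : GameEquiv G r q D (Sum.elim x b) (Sum.elim y b)) :
    GameEquiv G r q D (Sum.elim x c) (Sum.elim y c) :=
  ((h x D hx).symm.trans hxy).trans (h y D hy)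

end SameTrace

namespace IsBase

lemma bot : IsBase μ G ⊥ q A J b := by
  rintro x y D - - hxy
  refine GameEquiv.of_eqOn ?_
  rintro _ (hi | ⟨j, -, rfl⟩)
  exacts [hxy.rel hi, rfl]

lemma mono {J' : Set κ} (h : IsBase μ G r q A J b) (hJ : J ⊆ J') : IsBase μ G r q A J' b := by
  intro x y D hx hy hxy
  refine (h x y _ hx.diff hy.diff (hxy.mono Set.sdiff_subset)).mono ?_
  rw [Set.sdiff_union_self]
  exact Set.union_subset_union_right D (Set.image_mono (Set.compl_subset_compl.2 hJ))

lemma of_far [Finite μ] [Finite κ] {c : V} (h : IsBase μ G r q A J b) (hrs : r ≤ s)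
    (hc : ∀ x y, s x y → r x y ∨ s x c)
    (hfar : ∀ j ∉ J, (Nat.card (μ ⊕ κ) + 1) * 2 ^ q < redDist G s c (b j)) :
    IsBase μ G s q A J b := by
  intro x y D hx hy hxy
  obtain ⟨l, hl, hgap⟩ := exists_redDist_gap G s q c (Sum.elim x b)
  have hle : (l : ℕ∞) * 2 ^ q ≤ (Nat.card (μ ⊕ κ) + 1) * 2 ^ q := by
    gcongr
    exact_mod_cast Nat.le_succ_of_le hl
  refine GameEquiv.of_gap (fun i _ => hgap i) (hxy.mono ?_) ?_
  · rintro _ ⟨hi | ⟨j, hj, rfl⟩, hnear⟩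
    · exact hi
    · exact absurd (hnear.trans hle) (hfar j hj).not_ge
  · have hsub : {i ∈ D | ¬redDist G s c (Sum.elim x b i) ≤ l * 2 ^ q} ⊆ D := Set.sep_subset _ _
    have hout : GameEquiv G r q {i ∈ D | ¬redDist G s c (Sum.elim x b i) ≤ l * 2 ^ q}
        (Sum.elim x b) (Sum.elim y b) :=
      (hxy.mono hsub).refine_of_far hrs hc fun i hi =>
        (le_add_of_nonneg_left zero_le).trans_lt (not_le.1 (mt (hgap i) hi.2))
    refine ((h x y _ (hx.mono hsub) (hy.mono hsub) hout).coarsen hrs).mono ?_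
    rintro i ⟨hi | hi, hnear⟩
    exacts [.inl ⟨hi, hnear⟩, .inr hi]

lemma mem_eventTimes {r : ℕ → Setoid V} {t : ℕ} (hr : Monotone r) (h : IsBase μ G (r t) q A J b)
    (h' : ¬IsBase μ G (r (t + 1)) q A J b) (hbc : SameTrace μ G (r t) q A J b c) :
    ∃ D : Set (μ ⊕ κ), t ∈ eventTimes G r q D fun _ => A ∪ c '' J := by
  unfold IsBase at h'
  push Not at h'
  obtain ⟨x, y, D, hx, hy, hw, hn⟩ := h'
  refine ⟨D, Sum.elim x c, Sum.elim y c, ?_, (hbc.coarsen (hr t.le_succ)).transfer hx hy hw,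
    fun hw' => hn ((h x y D hx hy (hbc.symm.transfer hx hy hw')).coarsen (hr t.le_succ))⟩
  rintro (i | j) hi
  · exact ⟨.inl (hx.1 i hi), .inl (hy.1 i hi)⟩
  · exact ⟨.inr ⟨j, hx.2 j hi, rfl⟩, .inr ⟨j, hx.2 j hi, rfl⟩⟩

end IsBase

lemma SameTrace.insert_index [Finite μ] [Finite κ] {i : κ} (h : SameTrace μ G r q A J b c)
    (hb : IsBase μ G r q A J b) (hc : IsBase μ G r q A J c)
    (hlocal : ∀ (x : μ → V) (D : Set (μ ⊕ κ)), Supported A J x D →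
      (∀ k ∈ D, redDist G r (b i) (Sum.elim x b k) ≤ Nat.card (μ ⊕ κ) * 2 ^ q) →
        ∃ y, Supported A J y D ∧ GameEquiv G r q D (Sum.elim x b) (Sum.elim y b) ∧
          GameEquiv G r q (insert (Sum.inr i) D) (Sum.elim y b) (Sum.elim y c)) :
    SameTrace μ G r q A (insert i J) b c := by
  by_cases hi : i ∈ J
  · rwa [Set.insert_eq_of_mem hi]
  intro x D hx
  obtain ⟨l, hl, hgap⟩ := exists_redDist_gap G r q (b i) (Sum.elim x b)
  refine GameEquiv.of_gap (fun k _ => hgap k) ?_ (h x _ ((hx.mono (Set.sep_subset _ _)).of_insert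
    fun hfar => hfar.2 (by simp [redDist_eq_zero.2 (r.refl _)])))
  set I := {k ∈ D | redDist G r (b i) (Sum.elim x b k) ≤ l * 2 ^ q}
  have hIx : Supported A J x (I \ {Sum.inr i}) :=
    (hx.mono (Set.sdiff_subset.trans (Set.sep_subset _ _))).of_insert fun h => h.2 rfl
  obtain ⟨y, hIy, hxy, hy⟩ := hlocal x _ hIx fun k hk => hk.1.2.trans (by gcongr)
  have hsub : I ⊆ insert (Sum.inr i) (I \ {Sum.inr i}) := by
    rw [Set.insert_sdiff_singleton]
    exact Set.subset_insert _ _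
  have hsub' : I ⊆ I \ {Sum.inr i} ∪ Sum.inr '' Jᶜ :=
    hsub.trans (Set.insert_subset (.inr ⟨i, hi, rfl⟩) Set.subset_union_left)
  exact ((hb x y _ hIx hIy hxy).mono hsub').trans ((hy.mono hsub).trans
    ((hc x y _ hIx hIy (h.transfer hIx hIy hxy)).mono hsub').symm)

end Traces

section Extensions

variable {V : Type u} {μ : Type v} {κ : Type w} {G : SimpleGraph V} {q : ℕ}

lemma SameTrace.redDist_eq {r : Setoid V} {A : Set V} {J : Set κ} {b c : κ → V}
    (h : SameTrace μ G r q A J b c) {x : μ → V} {D : Set (μ ⊕ κ)} (hx : Supported A J x D)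
    {k : μ ⊕ κ} (hk : k ∈ D) (v : V) :
    redDist G r v (Sum.elim x b k) = redDist G r v (Sum.elim x c k) :=
  redDist_congr (r.refl v) ((h x D hx).rel hk)

lemma exists_local_representatives (μ : Type v) [Finite μ] [Finite κ] (d q ρ : ℕ) :
    ∃ (Z : Type (max v w)) (_ : Finite Z), ∀ {V : Type u} {G : SimpleGraph V} {r : Setoid V},
      RedDegreeLE G r d → ∀ (A : Set V) (J : Set κ) (c : κ → V) (v : V),
        ∃ (f : Set (μ ⊕ κ) → (μ ⊕ κ → V) → Z) (rep : Set (μ ⊕ κ) → Z → μ → V),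
          (∀ D x y, (∀ k ∈ D, redDist G r v (x k) ≤ ρ) → (∀ k ∈ D, redDist G r v (y k) ≤ ρ) →
            f D x = f D y → GameEquiv G r q D x y) ∧
          ∀ (x : μ → V) (D : Set (μ ⊕ κ)), Supported A J x D →
            (∀ k ∈ D, redDist G r v (Sum.elim x c k) ≤ ρ) → ∃ z, Supported A J (rep D z) D ∧
              (∀ k ∈ D, redDist G r v (Sum.elim (rep D z) c k) ≤ ρ) ∧
              GameEquiv G r q D (Sum.elim x c) (Sum.elim (rep D z) c) := by
  obtain ⟨Z, _, code⟩ := exists_code_ball.{u} d q ρ (μ ⊕ κ)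
  refine ⟨Z, inferInstance, fun hd A J c v => ?_⟩
  obtain ⟨f, hf⟩ := code hd v
  have : Nonempty (μ → _) := ⟨fun _ => v⟩
  set S := fun D => {x : μ → _ |
    Supported A J x D ∧ ∀ k ∈ D, redDist _ _ v (Sum.elim x c k) ≤ ρ}
  refine ⟨f, fun D => Function.invFunOn (fun x => f D (Sum.elim x c)) (S D), hf,
    fun x D hx hnear => ⟨f D (Sum.elim x c), ?_⟩⟩
  have hex : ∃ y ∈ S D, f D (Sum.elim y c) = f D (Sum.elim x c) := ⟨x, ⟨hx, hnear⟩, rfl⟩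
  obtain ⟨hrep, hrep_near⟩ := Function.invFunOn_mem hex
  exact ⟨hrep, hrep_near, hf D _ _ hnear hrep_near (Function.invFunOn_eq hex).symm⟩

lemma exists_extensions_of_rel (μ : Type v) (κ : Type w) [Finite μ] [Finite κ] (d q : ℕ) :
    ∃ K : ℕ, ∀ {V : Type u} {G : SimpleGraph V} {r : Setoid V}, RedDegreeLE G r d →
      ∀ (A : Set V) (J : Set κ) (c : κ → V) (i : κ) (v : V), ∃ R : Set (κ → V), R.encard ≤ K ∧
        ∀ b, SameTrace μ G r q A J b c → IsBase μ G r q A J b → r (b i) v →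
          ∃ e ∈ R, SameTrace μ G r q A (insert i J) b e := by
  obtain ⟨Z, _, local_rep⟩ :=
    exists_local_representatives.{u} (κ := κ) μ d q (Nat.card (μ ⊕ κ) * 2 ^ q)
  refine ⟨Nat.card (Set (μ ⊕ κ) → Z → Z), fun {V G r} hd A J c i v => ?_⟩
  obtain ⟨f, rep, hf, hrep⟩ := local_rep hd A J c v
  obtain ⟨R, hRs, hR, hcode⟩ := exists_representatives
    (fun (b : κ → V) D z => f (insert (Sum.inr i) D) (Sum.elim (rep D z) b))
    {b | SameTrace μ G r q A J b c ∧ IsBase μ G r q A J b ∧ r (b i) v}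
  refine ⟨R, hR, fun b hbc hb hbv => ?_⟩
  obtain ⟨e, heR, hbe⟩ := hcode b ⟨hbc, hb, hbv⟩
  obtain ⟨hec, he, hev⟩ := hRs heR
  refine ⟨e, heR, (hbc.trans hec.symm).insert_index hb he fun x D hx hnear => ?_⟩
  obtain ⟨z, hz, hz_near, hxz⟩ := hrep x D hx fun k hk => by
    rw [← hbc.redDist_eq hx hk, ← redDist_congr hbv (r.refl _)]
    exact_mod_cast hnear k hk
  refine ⟨rep D z, hz, hbc.symm.transfer hx hz hxz, hf _ _ _ ?_ ?_ (congrFun₂ hbe D z)⟩ <;>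
    refine Set.forall_mem_insert.2 ⟨?_, fun k hk => ?_⟩
  · simp [redDist_eq_zero.2 (r.symm hbv)]
  · exact (hbc.redDist_eq hz hk v).trans_le (hz_near k hk)
  · simp [redDist_eq_zero.2 (r.symm hev)]
  · exact (hec.redDist_eq hz hk v).trans_le (hz_near k hk)

lemma exists_extensions_of_mem (μ : Type v) (κ : Type w) [Finite μ] [Finite κ] (d q L : ℕ) :
    ∃ K : ℕ, ∀ {V : Type u} {G : SimpleGraph V} {r : Setoid V}, RedDegreeLE G r d →
      ∀ {P : Set V}, (Quotient.mk r '' P).encard ≤ L → ∀ (A : Set V) (J : Set κ) (c : κ → V)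
        (i : κ), ∃ R : Set (κ → V), R.encard ≤ K ∧
          ∀ b, SameTrace μ G r q A J b c → IsBase μ G r q A J b → b i ∈ P →
            ∃ e ∈ R, SameTrace μ G r q A (insert i J) b e := by
  obtain ⟨K, extend⟩ := exists_extensions_of_rel.{u} μ κ d q
  refine ⟨L * K, fun {V G r} hd P hP A J c i => ?_⟩
  choose R hR hext using fun a : Quotient r => extend hd A J c i a.out
  refine ⟨⋃ a ∈ Quotient.mk r '' P, R a, ?_, fun b hbc hb hbP => ?_⟩
  · calc (⋃ a ∈ Quotient.mk r '' P, R a).encard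
        ≤ (Quotient.mk r '' P).encard * K :=
          encard_biUnion_le_mul fun a _ => hR a
      _ ≤ (L * K : ℕ) := by push_cast; gcongr
  · obtain ⟨e, he, hbe⟩ := hext ⟦b i⟧ b hbc hb (r.symm (Quotient.mk_out (b i)))
    exact ⟨e, Set.mem_biUnion (Set.mem_image_of_mem _ hbP) he, hbe⟩

lemma exists_extension_time {A : Set V} {J : Set κ} {b c : κ → V} [Finite μ] [Finite κ]
    {r : ℕ → Setoid V} (hr : Monotone r) {v : ℕ → V}
    (hv : ∀ t x y, r (t + 1) x y → r t x y ∨ r (t + 1) x (v t)) {N : ℕ} (hN : r N = ⊤)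
    {t₀ : ℕ} (hbc : SameTrace μ G (r t₀) q A J b c) (hb : IsBase μ G (r t₀) q A J b)
    (hJ : ∃ i, i ∉ J) :
    ∃ t ∈ insert (max t₀ N) (⋃ D : Set (μ ⊕ κ), eventTimes G r q D fun _ => A ∪ c '' J),
      t₀ ≤ t ∧ IsBase μ G (r t) q A J b ∧
        ∃ i ∉ J, redDist G (r (t + 1)) (v t) (b i) ≤ (Nat.card (μ ⊕ κ) + 1) * 2 ^ q := by
  by_contra! H
  have hbase : ∀ t ≥ t₀, IsBase μ G (r t) q A J b := by
    intro t ht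
    induction t, ht using Nat.le_induction with
    | base => exact hb
    | succ t ht ih =>
      by_contra h
      obtain ⟨D, hD⟩ := ih.mem_eventTimes hr h (hbc.coarsen (hr ht))
      exact h (ih.of_far (hr t.le_succ) (hv t) (H t (.inr (Set.mem_iUnion_of_mem D hD)) ht ih))
  obtain ⟨i, hi⟩ := hJ
  have hfar := H (max t₀ N) (.inl rfl) (le_max_left _ _) (hbase _ (le_max_left _ _)) i hi
  have htop : r (max t₀ N + 1) = ⊤ :=
    top_le_iff.1 (hN.ge.trans (hr ((le_max_right t₀ N).trans (Nat.le_succ _))))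
  rw [redDist_eq_zero.2 (htop ▸ trivial)] at hfar
  exact not_lt_zero hfar

end Extensions

section Descriptions

variable {V : Type u} {μ : Type v} {κ : Type w} {G : SimpleGraph V} {q : ℕ}

/-- The triple `δ = (t, J, c)` describes the tuple `b`: at time `t` the indices in `J` are a base of
`b`, and the entries of `c` at these indices have the same trace as those of `b`. -/
def Describes (μ : Type v) (G : SimpleGraph V) (r : ℕ → Setoid V) (q : ℕ) (A : Set V)
    (δ : ℕ × Set κ × (κ → V)) (b : κ → V) : Prop :=
  SameTrace μ G (r δ.1) q A δ.2.1 b δ.2.2 ∧ IsBase μ G (r δ.1) q A δ.2.1 b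

lemma exists_encard_extensionTimes_le (μ : Type v) (κ : Type w) [Finite μ] [Finite κ] (d q : ℕ) :
    ∃ K : ℕ, ∀ {V : Type u} {G : SimpleGraph V} {r : ℕ → Setoid V}, IsMergeSequence G d r →
      ∀ {A : Set V}, A.Nonempty → ∀ (J : Set κ) (c : κ → V) (N : ℕ),
        (insert N (⋃ D : Set (μ ⊕ κ), eventTimes G r q D fun _ => A ∪ c '' J)).encard ≤
          K * A.encard := by
  obtain ⟨K, hK⟩ := exists_encard_eventTimes_le.{u} d q (μ ⊕ κ)
  refine ⟨K * (1 + Nat.card κ) + 1, fun {V G r} hS A hA J c N => ?_⟩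
  have hone : 1 ≤ A.encard := Set.one_le_encard_iff_nonempty.2 hA
  have hcJ : (c '' J).encard ≤ Nat.card κ := calc
    (c '' J).encard ≤ J.encard := Set.encard_image_le c J
    _ ≤ Nat.card κ := by
      rw [← ENat.card_eq_coe_natCard, ← Set.encard_univ]
      exact Set.encard_le_encard (Set.subset_univ J)
  calc _ ≤ (K * (A ∪ c '' J).encard + 1 : ℕ∞) := (Set.encard_insert_le _ _).trans <| by
        gcongr
        exact hK hS hA.inl
    _ ≤ K * (A.encard + Nat.card κ * A.encard) + A.encard := by
        gcongr
        refine (Set.encard_union_le _ _).trans ?_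
        gcongr
        exact hcJ.trans (le_mul_of_one_le_right zero_le hone)
    _ = (K * (1 + Nat.card κ) + 1 : ℕ) * A.encard := by
        push_cast
        ring

lemma exists_refined_descriptions (μ : Type v) (κ : Type w) [Finite μ] [Finite κ] (d q : ℕ) :
    ∃ K : ℕ, ∀ {V : Type u} {G : SimpleGraph V} {r : ℕ → Setoid V}, IsMergeSequence G d r →
      ∀ {A : Set V}, A.Nonempty → ∀ δ : ℕ × Set κ × (κ → V), δ.2.1 ≠ Set.univ →
        ∃ R : Set (ℕ × Set κ × (κ → V)), R.encard ≤ K * A.encard ∧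
          ∀ b, Describes μ G r q A δ b → ∃ ε ∈ R,
            ε.2.1.encard = δ.2.1.encard + 1 ∧ Describes μ G r q A ε b := by
  obtain ⟨K, hK⟩ := exists_encard_extensionTimes_le.{u} μ κ d q
  set ρ := (Nat.card (μ ⊕ κ) + 1) * 2 ^ q
  obtain ⟨L, extend⟩ := exists_extensions_of_mem.{u} μ κ d q ((d + 1) ^ ρ + 2)
  refine ⟨K * (Nat.card κ * L), fun {V G r} hS A hA ⟨t₀, J, c⟩ hJ => ?_⟩
  obtain ⟨N, hN⟩ := hS.exists_eq_top
  choose v hv hball using hS.exists_center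
  choose R hR hext using fun t i => extend (hS.redDegreeLE t) (hball t ρ) A J c i
  set T := insert (max t₀ N) (⋃ D : Set (μ ⊕ κ), eventTimes G r q D fun _ => A ∪ c '' J)
  have hT : T.encard ≤ K * A.encard := hK hS hA J c _
  refine ⟨⋃ t ∈ T, ⋃ i ∈ Set.univ, (fun e => (t, insert i J, e)) '' R t i, ?_, ?_⟩
  · calc _ ≤ T.encard * (Nat.card κ * L : ℕ) := encard_biUnion_le_mul fun t _ => by
          push_cast
          rw [← ENat.card_eq_coe_natCard, ← Set.encard_univ]
          exact encard_biUnion_le_mul fun i _ =>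
            (Set.encard_image_le _ _).trans (hR t i)
      _ ≤ K * A.encard * (Nat.card κ * L : ℕ) := by gcongr
      _ = (K * (Nat.card κ * L) : ℕ) * A.encard := by
          push_cast
          ring
  · rintro b ⟨hbc, hb⟩
    obtain ⟨t, htT, ht, hbt, i, hiJ, hi⟩ :=
      exists_extension_time hS.mono hv hN hbc hb ((Set.ne_univ_iff_exists_notMem J).1 hJ)
    obtain ⟨e, he, hbe⟩ := hext t i b (hbc.coarsen (hS.mono ht)) hbt (by exact_mod_cast hi)
    exact ⟨(t, insert i J, e), Set.mem_biUnion htT (Set.mem_biUnion trivial ⟨e, he, rfl⟩),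
      Set.encard_insert_of_notMem hiJ, hbe, hbt.mono (Set.subset_insert i J)⟩

lemma exists_descriptions (μ : Type v) (κ : Type w) [Finite μ] [Finite κ] (d q : ℕ) {n : ℕ}
    (hn : n ≤ Nat.card κ) :
    ∃ K : ℕ, ∀ {V : Type u} {G : SimpleGraph V} {r : ℕ → Setoid V}, IsMergeSequence G d r →
      ∀ {A : Set V}, A.Nonempty →
        ∃ R : Set (ℕ × Set κ × (κ → V)), R.encard ≤ K * A.encard ^ n ∧
          ∀ b, ∃ δ ∈ R, δ.2.1.encard = n ∧ Describes μ G r q A δ b := by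
  induction n with
  | zero =>
    refine ⟨1, fun {V G r} hS A hA => ?_⟩
    obtain ⟨v, -⟩ := hA
    refine ⟨{(0, ∅, fun _ => v)}, by simp, fun b => ⟨_, rfl, by simp, ?_, ?_⟩⟩
    · exact fun x D hx => GameEquiv.of_eqOn fun
        | .inl _, _ => rfl
        | .inr j, hj => (hx.2 j hj).elim
    · rw [hS.zero]
      exact IsBase.bot
  | succ n ih =>
    obtain ⟨K, hK⟩ := ih (Nat.le_of_succ_le hn)
    obtain ⟨L, hL⟩ := exists_refined_descriptions.{u} μ κ d q
    refine ⟨K * L, fun {V G r} hS A hA => ?_⟩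
    obtain ⟨R, hR, hbR⟩ := hK hS hA
    have hne : ∀ δ ∈ {δ ∈ R | δ.2.1.encard = n}, δ.2.1 ≠ Set.univ := by
      rintro δ ⟨-, hδ⟩ huniv
      rw [huniv, Set.encard_univ, ENat.card_eq_coe_natCard] at hδ
      have := Nat.cast_injective hδ
      lia
    choose! S hS hbS using fun δ hδ => hL hS hA δ (hne δ hδ)
    refine ⟨⋃ δ ∈ {δ ∈ R | δ.2.1.encard = n}, S δ, ?_, fun b => ?_⟩
    · calc _ ≤ {δ ∈ R | δ.2.1.encard = n}.encard * (L * A.encard) :=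
            encard_biUnion_le_mul hS
        _ ≤ K * A.encard ^ n * (L * A.encard) := by
            gcongr
            exact (Set.encard_le_encard (Set.sep_subset _ _)).trans hR
        _ = (K * L : ℕ) * A.encard ^ (n + 1) := by
            push_cast
            ring
    · obtain ⟨δ, hδ, hδn, hδb⟩ := hbR b
      obtain ⟨ε, hε, hεδ, hεb⟩ := hbS δ ⟨hδ, hδn⟩ b hδb
      exact ⟨ε, Set.mem_biUnion ⟨hδ, hδn⟩ hε, by simp [hεδ, hδn], hεb⟩

end Descriptions

section Formulas

variable {V : Type u} {γ : Type w} {G : SimpleGraph V} {r : Setoid V} {q : ℕ}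

namespace GameEquiv

variable {κ : Type w} {x y : κ → V} {D : Set κ} {i j : κ}

lemma eq_iff_eq (h : GameEquiv G r q D x y) (hi : i ∈ D) (hj : j ∈ D) :
    x i = x j ↔ y i = y j :=
  (((h.of_le q.zero_le) _ ⟨i, hi, rfl⟩).2 _ ⟨j, hj, rfl⟩).1

lemma adj_iff_adj (h : GameEquiv G r q D x y) (hi : i ∈ D) (hj : j ∈ D) :
    G.Adj (x i) (x j) ↔ G.Adj (y i) (y j) :=
  (((h.of_le q.zero_le) _ ⟨i, hi, rfl⟩).2 _ ⟨j, hj, rfl⟩).2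

end GameEquiv

lemma Winning.gameEquiv_snoc {n : ℕ} {x y : γ → V} {xs ys : Fin n → V} {a b : V}
    (h : Winning G r q (insert (a, b) (pairs (Sum.elim x xs) (Sum.elim y ys) Set.univ))) :
    GameEquiv G r q Set.univ (Sum.elim x (Fin.snoc xs a : Fin (n + 1) → V))
      (Sum.elim y (Fin.snoc ys b : Fin (n + 1) → V)) := by
  refine h.mono ?_
  rintro _ ⟨i | i, -, rfl⟩
  · exact .inr ⟨.inl i, trivial, rfl⟩
  · cases i using Fin.lastCases with
    | last => exact .inl (by simp)
    | cast i => exact .inr ⟨.inr i, trivial, by simp⟩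

lemma exists_eq_var {L : Language} [L.IsRelational] : ∀ t : L.Term γ, ∃ i, t = Language.Term.var i
  | .var i => ⟨i, rfl⟩
  | .func f _ => isEmptyElim f

lemma exists_boundedFormula_realize_iff {n : ℕ} (φ : Language.graph.BoundedFormula γ n) : ∃ q : ℕ,
    ∀ {V : Type u} {G : SimpleGraph V} {r : Setoid V} {x y : γ → V} {xs ys : Fin n → V},
      GameEquiv G r q Set.univ (Sum.elim x xs) (Sum.elim y ys) →
        letI := G.structure
        (φ.Realize x xs ↔ φ.Realize y ys) := by
  induction φ with
  | falsum => exact ⟨0, fun _ => Iff.rfl⟩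
  | equal t₁ t₂ =>
    obtain ⟨i, rfl⟩ := exists_eq_var t₁
    obtain ⟨j, rfl⟩ := exists_eq_var t₂
    exact ⟨0, fun h => h.eq_iff_eq (Set.mem_univ i) (Set.mem_univ j)⟩
  | rel R ts =>
    obtain ⟨⟩ := R
    obtain ⟨i, hi⟩ := exists_eq_var (ts 0)
    obtain ⟨j, hj⟩ := exists_eq_var (ts 1)
    refine ⟨0, fun h => ?_⟩
    simpa only [Language.BoundedFormula.Realize, Language.Structure.RelMap, hi, hj,
      Language.Term.realize] using
      h.adj_iff_adj (Set.mem_univ i) (Set.mem_univ j)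
  | imp φ ψ hφ hψ =>
    obtain ⟨q₁, h₁⟩ := hφ
    obtain ⟨q₂, h₂⟩ := hψ
    exact ⟨max q₁ q₂, fun h => imp_congr (h₁ (h.of_le (le_max_left q₁ q₂)))
      (h₂ (h.of_le (le_max_right q₁ q₂)))⟩
  | all φ hφ =>
    obtain ⟨q, hq⟩ := hφ
    refine ⟨q + 1, fun h => ⟨fun hx b => ?_, fun hy a => ?_⟩⟩
    · obtain ⟨a, ha⟩ := h.2.2 b
      exact (hq ha.gameEquiv_snoc).1 (hx a)
    · obtain ⟨b, hb⟩ := h.2.1 a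
      exact (hq hb.gameEquiv_snoc).2 (hy b)

lemma exists_formula_realize_iff (φ : Language.graph.Formula γ) : ∃ q : ℕ,
    ∀ {V : Type u} {G : SimpleGraph V} {r : Setoid V} {x y : γ → V},
      GameEquiv G r q Set.univ x y →
        letI := G.structure
        (φ.Realize x ↔ φ.Realize y) := by
  obtain ⟨q, hq⟩ := exists_boundedFormula_realize_iff.{u} φ
  refine ⟨q, fun h => hq (Winning.mono h ?_)⟩
  rintro _ ⟨i | i, -, rfl⟩
  · exact ⟨i, trivial, rfl⟩
  · exact i.elim0

end Formulas

section Partitions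

variable {V : Type u} [Fintype V] [DecidableEq V] {P Q : Finpartition (Finset.univ : Finset V)}

/-- The equivalence relation whose classes are the parts of `P`. -/
def partSetoid (P : Finpartition (Finset.univ : Finset V)) : Setoid V :=
  Setoid.ker P.part

lemma partSetoid_iff {x y : V} : partSetoid P x y ↔ ∃ A ∈ P.parts, x ∈ A ∧ y ∈ A :=
  (P.mem_part_iff_part_eq_part (Finset.mem_univ x) (Finset.mem_univ y)).symm.trans
    P.mem_part_iff_exists

lemma partSetoid_bot : partSetoid (⊥ : Finpartition (Finset.univ : Finset V)) = ⊥ := by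
  ext x y
  simp [partSetoid_iff, Finpartition.parts_bot, eq_comm]

lemma partSetoid_eq_top (hP : P.parts = {Finset.univ}) : partSetoid P = ⊤ := by
  ext x y
  simp [partSetoid_iff, hP, Setoid.top_def]

lemma partSetoid_le_of_merge {A B : Finset V}
    (hQ : Q.parts = insert (A ∪ B) ((P.parts.erase A).erase B)) :
    partSetoid P ≤ partSetoid Q := by
  intro x y hxy
  obtain ⟨C, hC, hx, hy⟩ := partSetoid_iff.1 hxy
  rw [partSetoid_iff, hQ]
  by_cases hCA : C = A
  · exact ⟨A ∪ B, Finset.mem_insert_self _ _, by simp [← hCA, hx], by simp [← hCA, hy]⟩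
  by_cases hCB : C = B
  · exact ⟨A ∪ B, Finset.mem_insert_self _ _, by simp [← hCB, hx], by simp [← hCB, hy]⟩
  · exact ⟨C, by simp [hC, hCA, hCB], hx, hy⟩

lemma exists_partSetoid_of_merge {A B : Finset V} (hA : A ∈ P.parts) (hB : B ∈ P.parts)
    (hQ : Q.parts = insert (A ∪ B) ((P.parts.erase A).erase B)) :
    ∃ a b, ∀ x y, partSetoid Q x y →
      partSetoid P x y ∨ partSetoid Q x a ∧ (partSetoid P x a ∨ partSetoid P x b) := by
  obtain ⟨a, ha⟩ := P.nonempty_of_mem_parts hA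
  obtain ⟨b, hb⟩ := P.nonempty_of_mem_parts hB
  refine ⟨a, b, fun x y hxy => ?_⟩
  simp only [partSetoid_iff] at hxy ⊢
  obtain ⟨C, hC, hx, hy⟩ := hxy
  rw [hQ] at hC
  rcases Finset.mem_insert.1 hC with rfl | hC'
  · exact .inr ⟨⟨A ∪ B, hQ ▸ hC, hx, Finset.mem_union_left B ha⟩,
      (Finset.mem_union.1 hx).imp (⟨A, hA, ·, ha⟩) (⟨B, hB, ·, hb⟩)⟩
  · exact .inl ⟨C, Finset.mem_of_mem_erase (Finset.mem_of_mem_erase hC'), hx, hy⟩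

/-- The part of `P` that forms a given class of `partSetoid P`. -/
def partOfClass (P : Finpartition (Finset.univ : Finset V)) :
    Quotient (partSetoid P) → {A : Finset V // A ∈ P.parts} :=
  Quotient.lift (fun x => ⟨P.part x, P.part_mem.2 (Finset.mem_univ x)⟩) fun _ _ h => Subtype.ext h

lemma partOfClass_injective : Function.Injective (partOfClass P) :=
  Quotient.ind₂ fun _ _ h => Quotient.sound (congrArg Subtype.val h)

lemma mem_partOfClass (x : V) : x ∈ (partOfClass P ⟦x⟧).1 :=
  P.mem_part (Finset.mem_univ x)

lemma impurityGraph_adj_partOfClass {G : SimpleGraph V} {a b : Quotient (partSetoid P)}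
    (h : (redGraph G (partSetoid P)).Adj a b) :
    (impurityGraph G P).Adj (partOfClass P a) (partOfClass P b) := by
  obtain ⟨hne, ⟨x, y, rfl, rfl, hxy⟩, x', y', hx', hy', hxy'⟩ := h
  refine ⟨partOfClass_injective.ne hne, fun hc => hxy' (hc x' ?_ y' ?_),
    fun hc => hc x (mem_partOfClass x) y (mem_partOfClass y) hxy⟩
  · exact hx' ▸ mem_partOfClass x'
  · exact hy' ▸ mem_partOfClass y'

lemma redDegreeLE_maxDegree (G : SimpleGraph V) (P : Finpartition (Finset.univ : Finset V))
    [DecidableRel (impurityGraph G P).Adj] :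
    RedDegreeLE G (partSetoid P) (impurityGraph G P).maxDegree := by
  intro a
  calc ((redGraph G (partSetoid P)).neighborSet a).encard
      ≤ ((impurityGraph G P).neighborSet (partOfClass P a)).encard :=
        Set.encard_le_encard_of_injOn (fun _ hb => impurityGraph_adj_partOfClass hb)
          partOfClass_injective.injOn
    _ = (impurityGraph G P).degree (partOfClass P a) := by
        rw [Set.encard_eq_coe_toFinset_card, ← SimpleGraph.card_neighborFinset_eq_degree]
        rfl
    _ ≤ (impurityGraph G P).maxDegree := by
        exact_mod_cast SimpleGraph.degree_le_maxDegree _ _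

namespace ContractionSequence

variable (S : ContractionSequence V) [Nonempty V]

/-- The equivalence relation of the partition at time `t`; the sequence is extended by its last
partition. -/
def setoid (t : ℕ) : Setoid V :=
  partSetoid (S.partition ⟨min t (Fintype.card V - 1),
    (min_le_right _ _).trans_lt (Nat.sub_lt Fintype.card_pos one_pos)⟩)

lemma setoid_of_lt {t : ℕ} (ht : t < Fintype.card V) :
    S.setoid t = partSetoid (S.partition ⟨t, ht⟩) := by
  simp only [setoid, min_eq_left (Nat.le_sub_one_of_lt ht)]

lemma setoid_eq_top {t : ℕ} (ht : Fintype.card V ≤ t + 1) : S.setoid t = ⊤ :=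
  partSetoid_eq_top (S.last _ (by
    have := Fintype.card_pos (α := V)
    simp only
    lia))

lemma isMergeSequence {G : SimpleGraph V} {d : ℕ} (hd : S.width G ≤ d) :
    IsMergeSequence G d S.setoid where
  zero := by rw [S.setoid_of_lt Fintype.card_pos, S.first, partSetoid_bot]
  mono := by
    refine monotone_nat_of_le_succ fun t => ?_
    rcases Nat.lt_or_ge (t + 1) (Fintype.card V) with ht | ht
    · obtain ⟨A, -, B, -, -, hparts⟩ := S.step t ht
      rw [S.setoid_of_lt ht, S.setoid_of_lt (Nat.lt_of_succ_lt ht)]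
      exact partSetoid_le_of_merge hparts
    · exact le_top.trans_eq (S.setoid_eq_top (Nat.le_succ_of_le ht)).symm
  exists_merge t := by
    rcases Nat.lt_or_ge (t + 1) (Fintype.card V) with ht | ht
    · obtain ⟨A, hA, B, hB, -, hparts⟩ := S.step t ht
      rw [S.setoid_of_lt ht, S.setoid_of_lt (Nat.lt_of_succ_lt ht)]
      exact exists_partSetoid_of_merge hA hB hparts
    · obtain ⟨v⟩ := ‹Nonempty V›
      exact ⟨v, v, fun x y _ => .inl (S.setoid_eq_top ht ▸ trivial)⟩
  redDegreeLE t a := by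
    classical
    refine (redDegreeLE_maxDegree G _ a).trans (Nat.cast_le.2 (le_trans ?_ hd))
    exact Finset.le_sup (f := fun t => (impurityGraph G (S.partition t)).maxDegree)
      (Finset.mem_univ _)
  exists_eq_top := ⟨Fintype.card V, S.setoid_eq_top (Nat.le_succ _)⟩

end ContractionSequence

/-- The partition whose parts are `s` and the singletons of the vertices outside `s`. -/
def collapse (s : Finset V) (hs : s.Nonempty) : Finpartition (Finset.univ : Finset V) :=
  (⊥ : Finpartition sᶜ).extend hs.ne_empty disjoint_compl_left compl_sup_eq_top

lemma collapse_singleton (v : V) : collapse {v} (Finset.singleton_nonempty v) = ⊥ := by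
  ext1
  rw [collapse, Finpartition.extend_parts, Finpartition.parts_bot, Finpartition.parts_bot,
    ← Finset.insert_compl_self v, Finset.map_insert]
  rfl

lemma collapse_insert {s : Finset V} (hs : s.Nonempty) {a : V} (ha : a ∉ s) :
    s ∈ (collapse s hs).parts ∧ {a} ∈ (collapse s hs).parts ∧ s ≠ {a} ∧
      (collapse (insert a s) (s.insert_nonempty a)).parts =
        insert (s ∪ {a}) (((collapse s hs).parts.erase s).erase {a}) := by
  have hsa : ∀ x ∉ s, {x} ≠ s := fun x hx h => hx (h ▸ Finset.mem_singleton_self x)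
  refine ⟨by simp [collapse], by simp [collapse, ha], (hsa a ha).symm, ?_⟩
  rw [collapse, collapse, Finpartition.extend_parts, Finpartition.extend_parts,
    Finpartition.parts_bot, Finpartition.parts_bot, Finset.erase_insert (by simpa using hsa),
    Finset.compl_insert, Finset.map_erase, Finset.union_comm s]
  rfl

lemma nonempty_contractionSequence : Nonempty (ContractionSequence V) := by
  let e := Fintype.equivFin V
  let low (t : ℕ) : Finset V := {x | (e x : ℕ) ≤ t}
  have hlow : ∀ t : Fin (Fintype.card V), (low t).Nonempty := fun t =>
    ⟨e.symm t, by simp [low]⟩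
  refine ⟨⟨fun t => collapse (low t) (hlow t), fun h => ?_, fun t ht => ?_, fun t h => ?_⟩⟩
  · have hzero : low 0 = {e.symm ⟨0, h⟩} := by
      ext x
      simp [low, Equiv.eq_symm_apply, Fin.ext_iff]
    simp only [hzero, collapse_singleton]
  · have huniv : low t = Finset.univ := by
      ext x
      simp [low]
      lia
    simp [huniv, collapse]
  · let a := e.symm ⟨t + 1, h⟩
    have hsucc : low (t + 1) = insert a (low t) := by
      ext x
      simp [low, a, Equiv.eq_symm_apply, Fin.ext_iff]
      lia
    obtain ⟨hs, ha, hne, hparts⟩ := collapse_insert (hlow ⟨t, Nat.lt_of_succ_lt h⟩) (a := a)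
      (by simp [low, a])
    refine ⟨_, hs, _, ha, hne, ?_⟩
    simp only [hsucc, hparts]

lemma twinWidth_bot (V : Type u) [Fintype V] [DecidableEq V] :
    twinWidth (⊥ : SimpleGraph V) = 0 := by
  classical
  obtain ⟨S⟩ := nonempty_contractionSequence (V := V)
  have hbot : ∀ P : Finpartition (Finset.univ : Finset V), impurityGraph ⊥ P = ⊥ := fun P =>
    le_bot_iff.1 fun A B h => h.2.2 fun _ _ _ _ => id
  have hwidth : S.width (⊥ : SimpleGraph V) = 0 :=
    Nat.le_zero.1 (Finset.sup_le fun t _ => by simp [hbot])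
  exact nonpos_iff_eq_zero.1 ((iInf_le _ S).trans (by simp [hwidth]))

end Partitions

section StoneSpaces

variable {α : Type v} {β : Type w} {V : Type u} {G : SimpleGraph V}

lemma exists_width_le [Fintype V] [DecidableEq V] {d : ℕ} (hG : twinWidth G ≤ d) :
    ∃ S : ContractionSequence V, S.width G ≤ d := by
  obtain ⟨S, hS⟩ := iInf_lt_iff.1 (hG.trans_lt (Nat.cast_lt.2 d.lt_succ_self))
  exact ⟨S, Nat.lt_succ_iff.1 (Nat.cast_lt.1 hS)⟩

lemma exists_ncard_stoneSpace_le [Finite α] [Fintype β] (d : ℕ)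
    (φ : Language.graph.Formula (α ⊕ β)) :
    ∃ C : ℕ, ∀ (V : Type u) [Fintype V] [DecidableEq V] (G : SimpleGraph V) (A : Finset V),
      A.Nonempty → twinWidth G ≤ d →
        (stoneSpace G φ A).ncard ≤ C * A.card ^ Fintype.card β := by
  obtain ⟨q, hq⟩ := exists_formula_realize_iff.{u} φ
  obtain ⟨K, hK⟩ := exists_descriptions.{u} α β d q le_rfl
  refine ⟨K, fun V _ _ G A hA hG => ?_⟩
  have : Nonempty V := hA.to_type
  obtain ⟨S, hS⟩ := exists_width_le hG
  obtain ⟨R, hR, hbR⟩ := hK (S.isMergeSequence hS) (A := A) hA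
  have hsub : stoneSpace G φ A ⊆ (fun δ => definedSet G φ A δ.2.2) '' R := by
    rintro _ ⟨b, rfl⟩
    obtain ⟨⟨t, J, c⟩, hδ, hJ, hbc, -⟩ := hbR b
    obtain rfl : J = Set.univ := by
      refine Set.Finite.eq_of_subset_of_encard_le (Set.toFinite _) (Set.subset_univ J) ?_
      rw [hJ, Set.encard_univ, ENat.card_eq_coe_natCard]
    refine ⟨_, hδ, Set.ext fun a => and_congr_right fun ha => (hq (hbc a _ ⟨?_, ?_⟩)).symm⟩
    · exact fun i _ => ha i
    · exact fun j _ => Set.mem_univ j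
  rw [Set.encard_coe_eq_coe_finsetCard, Nat.card_eq_fintype_card] at hR
  refine ENat.toNat_le_of_le_natCast ?_
  calc (stoneSpace G φ A).encard ≤ R.encard :=
        (Set.encard_le_encard hsub).trans (Set.encard_image_le _ R)
    _ ≤ (K * A.card ^ Fintype.card β : ℕ) := mod_cast hR

/-- The formula expressing that the variable `i` is equal to one of the variables in `β`. -/
noncomputable def memFormula (β : Type w) [Finite β] (i : α) : Language.graph.Formula (α ⊕ β) :=
  Language.BoundedFormula.iSup fun j : β =>
    Language.Term.equal (Language.Term.var (Sum.inl i)) (Language.Term.var (Sum.inr j))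

variable [Finite β] {i : α} {A : Finset V} {b c : β → V}

lemma mem_definedSet_memFormula {a : α → V} :
    a ∈ definedSet G (memFormula β i) A b ↔ (∀ k, a k ∈ A) ∧ a i ∈ Set.range b := by
  let := G.structure
  refine and_congr_right fun _ => ?_
  rw [memFormula, Language.Formula.Realize, Language.BoundedFormula.realize_iSup]
  exact exists_congr fun j => Language.Formula.realize_equal.trans eq_comm

lemma range_subset_of_definedSet_memFormula_eq (hb : ∀ j, b j ∈ A)
    (h : definedSet G (memFormula β i) A b = definedSet G (memFormula β i) A c) :
    Set.range b ⊆ Set.range c := by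
  rintro _ ⟨j, rfl⟩
  have hmem : (fun _ => b j) ∈ definedSet G (memFormula β i) A b :=
    mem_definedSet_memFormula.2 ⟨fun _ => hb j, j, rfl⟩
  rw [h] at hmem
  exact (mem_definedSet_memFormula.1 hmem).2

lemma encard_fiber_definedSet_memFormula_le (Z : Set (α → V)) :
    {b : β → V | (∀ j, b j ∈ A) ∧ definedSet G (memFormula β i) A b = Z}.encard ≤
      (Nat.card β ^ Nat.card β : ℕ) := by
  rcases Set.eq_empty_or_nonempty
    {b : β → V | (∀ j, b j ∈ A) ∧ definedSet G (memFormula β i) A b = Z} with h | ⟨c, -, hc⟩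
  · simp [h]
  have hsub : {b : β → V | (∀ j, b j ∈ A) ∧ definedSet G (memFormula β i) A b = Z} ⊆
      Set.pi Set.univ fun _ => Set.range c := fun b hb j _ =>
    range_subset_of_definedSet_memFormula_eq hb.1 (hb.2.trans hc.symm) ⟨j, rfl⟩
  have hrange : (Set.range c).encard ≤ Nat.card β := by
    rw [← Set.image_univ, ← ENat.card_eq_coe_natCard, ← Set.encard_univ]
    exact Set.encard_image_le c Set.univ
  exact (Set.encard_le_encard hsub).trans (mod_cast encard_pi_univ_le fun _ => hrange)

lemma card_pow_le_encard_stoneSpace_mul (G : SimpleGraph V) (A : Finset V) (i : α) :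
    (A.card : ℕ∞) ^ Nat.card β ≤
      (stoneSpace G (memFormula β i) A).encard * (Nat.card β ^ Nat.card β : ℕ) := by
  have := Fintype.ofFinite β
  calc (A.card : ℕ∞) ^ Nat.card β
      = (Set.pi Set.univ fun _ : β => (A : Set V)).encard := by
        simp [Set.encard_pi_eq_prod_encard]
    _ ≤ (⋃ Z ∈ stoneSpace G (memFormula β i) A,
          {b : β → V | (∀ j, b j ∈ A) ∧ definedSet G (memFormula β i) A b = Z}).encard :=
        Set.encard_le_encard fun b hb =>
          Set.mem_biUnion (Set.mem_range_self b) ⟨fun j => hb j trivial, rfl⟩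
    _ ≤ _ := encard_biUnion_le_mul fun Z _ => encard_fiber_definedSet_memFormula_le Z

end StoneSpaces

end TwinWidth

theorem theorem1p3 {α : Type v} {β : Type w} [Fintype α] [Fintype β] :
    -- the upper bound, with a constant that depends on `d` and `φ` only
    (∀ (d : ℕ) (φ : Language.graph.Formula (α ⊕ β)), ∃ C : ℕ,
      ∀ (V : Type u) [Fintype V] [DecidableEq V] (G : SimpleGraph V) (A : Finset V),
        A.Nonempty → TwinWidth.twinWidth G ≤ (d : ℕ∞) →
          (TwinWidth.stoneSpace G φ A).ncard ≤ C * A.card ^ Fintype.card β) ∧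
    -- optimality, already for edgeless graphs (which have twin-width 0)
    (Nonempty α → ∃ (φ : Language.graph.Formula (α ⊕ β)) (c : ℝ), 0 < c ∧
      ∀ (V : Type u) [Fintype V] [DecidableEq V] (A : Finset V),
        TwinWidth.twinWidth (⊥ : SimpleGraph V) = 0 ∧
          c * (A.card : ℝ) ^ Fintype.card β ≤
            ((TwinWidth.stoneSpace (⊥ : SimpleGraph V) φ A).ncard : ℝ)) := by
  refine ⟨TwinWidth.exists_ncard_stoneSpace_le, fun ⟨i⟩ => ?_⟩
  have hpos : (0 : ℝ) < (Fintype.card β ^ Fintype.card β : ℕ) :=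
    Nat.cast_pos.2 Nat.pow_self_pos
  refine ⟨TwinWidth.memFormula β i, _, inv_pos.2 hpos, fun V _ _ A =>
    ⟨TwinWidth.twinWidth_bot V, ?_⟩⟩
  rw [inv_mul_le_iff₀ hpos, mul_comm]
  have hle := TwinWidth.card_pow_le_encard_stoneSpace_mul (β := β) (⊥ : SimpleGraph V) A i
  rw [TwinWidth.stoneSpace, ← (Set.finite_range _).cast_ncard_eq, Nat.card_eq_fintype_card] at hle
  exact_mod_cast hle
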